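/- Let $J=\begin{pmatrix}0&0&1\\0&I_2&0\\1&0&0\end{pmatrix}$ and let $\langle z,w\rangle = w^*Jz$ be the corresponding Hermitian form of signature $(3,1)$ on $\mathbb C^4$. Let $\mathbf{SU}(3,1)=\{A\in \mathrm{SL}(4,\mathbb C): A^*JA=J\}$, which acts on complex hyperbolic space $\mathbf H^3_{\mathbb C}$ (the set of negative lines in $\mathbb P(\mathbb C^4)$) and on its boundary $\partial\mathbf H^3_{\mathbb C}$ (the set of null lines). Let $\mathbf{SO}(3,1)$ be the group of matrices in $\mathbf{SU}(3,1)$ with real entries, and let $$\mathbf{SU}(1,1)\times\mathbf{SU}(2)=\left\{\begin{pmatrix}a&0&0&d\\0&f&g&0\\0&m&n&0\\q&0&0&t\end{pmatrix} : \begin{pmatrix}a&d\\q&t\end{pmatrix}\in\mathbf{SU}(1,1),\ \begin{pmatrix}f&g\\m&n\end{pmatrix}\in\mathbf{SU}(2)\right\}\subset\mathbf{SU}(3,1),$$ where $\mathbf{SU}(1,1)$ is the special unitary group of the Hermitian form on $\mathbb C^2$ with matrix $\begin{pmatrix}0&1\\1&0\end{pmatrix}$ and $\mathbf{SU}(2)$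 is that of the standard form. **Theorem.** Let $\Gamma<\mathbf{SU}(3,1)$ be a non-elementary complex hyperbolic Kleinian group, that is, a discrete subgroup of $\mathbf{SU}(3,1)$ which has no finite orbit in $\mathbf H^3_{\mathbb C}\cup\partial\mathbf H^3_{\mathbb C}$. Then $\operatorname{tr}(\gamma)\in\mathbb R$ for all $\gamma\in\Gamma$ if and only if $\Gamma$ is conjugate in $\mathbf{SU}(3,1)$ to a subgroup of $\mathbf{SO}(3,1)$ or to a subgroup of $\mathbf{SU}(1,1)\times\mathbf{SU}(2)$. -/

import Mathlib

open Matrix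
open scoped LinearAlgebra.Projectivization

/-- The group of matrices `A` of determinant one with `A* J A = J`. Over `ℂ` this is the special
unitary group of the Hermitian form with Gram matrix `J`; over `ℝ`, where `star` is trivial and
`A*` is the transpose, it is the special orthogonal group of the symmetric form `J`. -/
def specialIsometryGroup {n R : Type*} [Fintype n] [DecidableEq n] [CommRing R] [StarRing R]
    (J : Matrix n n R) : Subgroup (Matrix.SpecialLinearGroup n R) where
  carrier := {A | A.valᴴ * J * A.val = J}
  one_mem' := by simp
  mul_mem' := by
    intro A B (hA : A.valᴴ * J * A.val = J) (hB : B.valᴴ * J * B.val = J)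
    change (A.val * B.val)ᴴ * J * (A.val * B.val) = J
    calc (A.val * B.val)ᴴ * J * (A.val * B.val)
        = B.valᴴ * (A.valᴴ * J * A.val) * B.val := by
          rw [conjTranspose_mul]; simp only [Matrix.mul_assoc]
      _ = J := by rw [hA, hB]
  inv_mem' := by
    intro A (hA : A.valᴴ * J * A.val = J)
    change (A⁻¹).valᴴ * J * (A⁻¹).val = J
    have h : A.val * (A⁻¹).val = 1 := congrArg Subtype.val (mul_inv_cancel A)
    have h' : (A⁻¹).valᴴ * A.valᴴ = 1 := by rw [← conjTranspose_mul, h, conjTranspose_one]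
    calc (A⁻¹).valᴴ * J * (A⁻¹).val = (A⁻¹).valᴴ * (A.valᴴ * J * A.val) * (A⁻¹).val := by rw [hA]
      _ = ((A⁻¹).valᴴ * A.valᴴ) * J * (A.val * (A⁻¹).val) := by
          simp only [Matrix.mul_assoc]
      _ = J := by rw [h, h', Matrix.one_mul, Matrix.mul_one]

/-- The Gram matrix of the second Hermitian form on `ℂ⁴`, of signature `(3,1)`. -/
def formJ (R : Type*) [CommRing R] : Matrix (Fin 4) (Fin 4) R :=
  !![0, 0, 0, 1;
     0, 1, 0, 0;
     0, 0, 1, 0;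
     1, 0, 0, 0]

/-- The Hermitian form `⟨z, w⟩ = w* J z` on `ℂ⁴`. -/
def hermForm (z w : Fin 4 → ℂ) : ℂ := star w ⬝ᵥ (formJ ℂ *ᵥ z)

/-- `SU(3,1)`. -/
def SU31 : Subgroup (Matrix.SpecialLinearGroup (Fin 4) ℂ) := specialIsometryGroup (formJ ℂ)

/-- `SO(3,1)`, the matrices in `SU(3,1)` with real entries. -/
def SO31 : Subgroup (Matrix.SpecialLinearGroup (Fin 4) ℂ) :=
  (specialIsometryGroup (formJ ℝ)).map (Matrix.SpecialLinearGroup.map Complex.ofRealHom)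

/-- `SU(1,1)`, for the Hermitian form `z₁ w̄₂ + z₂ w̄₁` on `ℂ²`. -/
def SU11 : Subgroup (Matrix.SpecialLinearGroup (Fin 2) ℂ) :=
  specialIsometryGroup !![0, 1; 1, 0]

/-- `SU(2)`, for the standard Hermitian form on `ℂ²`. -/
def SU2 : Subgroup (Matrix.SpecialLinearGroup (Fin 2) ℂ) := specialIsometryGroup 1

/-- The matrix with block `B` in rows and columns `1, 4` and block `C` in rows and columns
`2, 3`. -/
def blockMatrix (B C : Matrix (Fin 2) (Fin 2) ℂ) : Matrix (Fin 4) (Fin 4) ℂ :=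
  !![B 0 0, 0, 0, B 0 1;
     0, C 0 0, C 0 1, 0;
     0, C 1 0, C 1 1, 0;
     B 1 0, 0, 0, B 1 1]

theorem blockMatrix_one : blockMatrix 1 1 = 1 := by
  ext i j
  fin_cases i <;> fin_cases j <;> simp [blockMatrix]

theorem blockMatrix_mul (B C B' C' : Matrix (Fin 2) (Fin 2) ℂ) :
    blockMatrix (B * B') (C * C') = blockMatrix B C * blockMatrix B' C' := by
  ext i j
  fin_cases i <;> fin_cases j <;> simp [blockMatrix, Matrix.mul_apply, Fin.sum_univ_succ]

theorem det_blockMatrix (B C : Matrix (Fin 2) (Fin 2) ℂ) :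
    (blockMatrix B C).det = B.det * C.det := by
  simp [blockMatrix, det_succ_row_zero, Fin.sum_univ_succ, Fin.succAbove]
  ring

/-- The block embedding of `SL(2) × SL(2)` in `SL(4)`. -/
def blockEmbedding :
    Matrix.SpecialLinearGroup (Fin 2) ℂ × Matrix.SpecialLinearGroup (Fin 2) ℂ →*
      Matrix.SpecialLinearGroup (Fin 4) ℂ where
  toFun P := ⟨blockMatrix P.1.val P.2.val, by
    rw [det_blockMatrix, P.1.property, P.2.property, mul_one]⟩
  map_one' := Subtype.ext blockMatrix_one
  map_mul' P Q := Subtype.ext (blockMatrix_mul P.1.val P.2.val Q.1.val Q.2.val)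

/-- `SU(1,1) × SU(2)` as a block subgroup of `SU(3,1)`. -/
def SU11xSU2 : Subgroup (Matrix.SpecialLinearGroup (Fin 4) ℂ) := (SU11.prod SU2).map blockEmbedding

/-- Complex hyperbolic 3-space: the negative lines in `ℂ⁴`. -/
def complexHyperbolicSpace : Set (ℙ ℂ (Fin 4 → ℂ)) := {p | (hermForm p.rep p.rep).re < 0}

/-- The boundary at infinity of complex hyperbolic 3-space: the null lines in `ℂ⁴`. -/
def complexHyperbolicBoundary : Set (ℙ ℂ (Fin 4 → ℂ)) := {p | (hermForm p.rep p.rep).re = 0}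

/-- A group of matrices acting on complex hyperbolic 3-space is elementary if it has a finite
orbit in the union of this space and its boundary. -/
def IsElementary (Γ : Subgroup (Matrix.SpecialLinearGroup (Fin 4) ℂ)) : Prop :=
  ∃ p ∈ complexHyperbolicSpace ∪ complexHyperbolicBoundary, (MulAction.orbit Γ p).Finite

local notation "β" => hermForm
local notation "conj" => starRingEnd ℂ

theorem hermForm_apply (z w : Fin 4 → ℂ) :
    β z w = z 3 * conj (w 0) + z 1 * conj (w 1) + z 2 * conj (w 2) + z 0 * conj (w 3) := by
  simp [hermForm, formJ, dotProduct, mulVec, Fin.sum_univ_succ]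
  ring

@[simp] theorem hermForm_add_left (x y z : Fin 4 → ℂ) : β (x + y) z = β x z + β y z := by
  simp [hermForm, mulVec_add]

@[simp] theorem hermForm_smul_left (c : ℂ) (x z : Fin 4 → ℂ) : β (c • x) z = c * β x z := by
  simp [hermForm, mulVec_smul]

@[simp] theorem hermForm_add_right (x y z : Fin 4 → ℂ) : β x (y + z) = β x y + β x z := by
  simp [hermForm]

@[simp] theorem hermForm_smul_right (c : ℂ) (x z : Fin 4 → ℂ) : β x (c • z) = conj c * β x z := by
  simp [hermForm]

@[simp] theorem hermForm_zero_left (x : Fin 4 → ℂ) : β 0 x = 0 := by simp [hermForm]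

@[simp] theorem hermForm_zero_right (x : Fin 4 → ℂ) : β x 0 = 0 := by simp [hermForm]

@[simp] theorem hermForm_neg_left (x y : Fin 4 → ℂ) : β (-x) y = -β x y := by
  simp [hermForm, mulVec_neg]

@[simp] theorem hermForm_neg_right (x y : Fin 4 → ℂ) : β x (-y) = -β x y := by simp [hermForm]

@[simp] theorem hermForm_sub_left (x y z : Fin 4 → ℂ) : β (x - y) z = β x z - β y z := by
  simp [sub_eq_add_neg]

@[simp] theorem hermForm_sub_right (x y z : Fin 4 → ℂ) : β x (y - z) = β x y - β x z := by
  simp [sub_eq_add_neg]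

theorem conj_hermForm (x y : Fin 4 → ℂ) : conj (β x y) = β y x := by
  simp [hermForm_apply]
  ring

theorem hermForm_eq_zero_comm {x y : Fin 4 → ℂ} (h : β x y = 0) : β y x = 0 := by
  rw [← conj_hermForm, h, map_zero]

theorem hermForm_self_eq_re (x : Fin 4 → ℂ) : β x x = ((β x x).re : ℂ) :=
  (Complex.conj_eq_iff_re.mp (conj_hermForm x x)).symm

theorem hermForm_self_smul_re (c : ℂ) (x : Fin 4 → ℂ) :
    (β (c • x) (c • x)).re = Complex.normSq c * (β x x).re := by
  rw [hermForm_smul_left, hermForm_smul_right, ← mul_assoc, Complex.mul_conj, Complex.re_ofReal_mul]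

theorem hermForm_nondegenerate {x : Fin 4 → ℂ} (h : ∀ y, β x y = 0) : x = 0 := by
  have h0 := h (Pi.single 3 1)
  have h1 := h (Pi.single 1 1)
  have h2 := h (Pi.single 2 1)
  have h3 := h (Pi.single 0 1)
  simp [hermForm_apply] at h0 h1 h2 h3
  ext i
  fin_cases i <;> assumption

theorem hermForm_self_pos {z : Fin 4 → ℂ} (h : z 0 = z 3) (hz : z ≠ 0) : 0 < (β z z).re := by
  have hs : (β z z).re = Complex.normSq (z 3) + Complex.normSq (z 1) + Complex.normSq (z 2)
      + Complex.normSq (z 3) := by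
    rw [hermForm_apply, h]
    simp [Complex.normSq_apply]
  rw [hs]
  by_contra hneg
  have a3 := Complex.normSq_nonneg (z 3)
  have a1 := Complex.normSq_nonneg (z 1)
  have a2 := Complex.normSq_nonneg (z 2)
  have b3 : z 3 = 0 := Complex.normSq_eq_zero.mp (by linarith)
  have b1 : z 1 = 0 := Complex.normSq_eq_zero.mp (by linarith)
  have b2 : z 2 = 0 := Complex.normSq_eq_zero.mp (by linarith)
  apply hz
  ext i
  fin_cases i <;> simp [b1, b2, b3, h]

/-- Two orthogonal vectors that are both negative or null are proportional. -/
theorem exists_smul_of_hermForm_nonpos {x y : Fin 4 → ℂ} (hx0 : x ≠ 0) (hx : (β x x).re ≤ 0)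
    (hy : (β y y).re ≤ 0) (hxy : β x y = 0) : ∃ c : ℂ, y = c • x := by
  have hyx := hermForm_eq_zero_comm hxy
  have hb : x 0 - x 3 ≠ 0 := fun hb => by
    have := hermForm_self_pos (sub_eq_zero.mp hb) hx0
    linarith
  set a := y 0 - y 3 with ha
  set b := x 0 - x 3 with hbd
  have hz : a • x - b • y = 0 := by
    by_contra hz
    have hpos := hermForm_self_pos (z := a • x - b • y) (by simp [ha, hbd]; ring) hz
    have he : β (a • x - b • y) (a • x - b • y) = β (a • x) (a • x) + β (b • y) (b • y) := by
      simp [hxy, hyx]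
    rw [he, Complex.add_re, hermForm_self_smul_re, hermForm_self_smul_re] at hpos
    have := mul_nonneg (Complex.normSq_nonneg a) (neg_nonneg.mpr hx)
    have := mul_nonneg (Complex.normSq_nonneg b) (neg_nonneg.mpr hy)
    linarith
  refine ⟨a / b, ?_⟩
  rw [sub_eq_zero] at hz
  rw [div_eq_inv_mul, mul_smul, hz, smul_smul, inv_mul_cancel₀ hb, one_smul]

theorem ne_zero_of_hermForm_neg {x : Fin 4 → ℂ} (hx : (β x x).re < 0) : x ≠ 0 := by
  rintro rfl
  simp at hx

theorem hermForm_pos_of_orthogonal {x y : Fin 4 → ℂ} (hx : (β x x).re < 0)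
    (hxy : β x y = 0) (hy : y ≠ 0) : 0 < (β y y).re := by
  by_contra h
  obtain ⟨c, rfl⟩ := exists_smul_of_hermForm_nonpos (ne_zero_of_hermForm_neg hx) hx.le
    (not_lt.mp h) hxy
  rw [hermForm_smul_right, mul_eq_zero] at hxy
  rcases hxy with hc | hc
  · exact hy (by simp [(map_eq_zero _).mp hc])
  · simp [hc] at hx

/-- The adjoint of a matrix with respect to the Hermitian form. -/
def hermAdjoint (X : Matrix (Fin 4) (Fin 4) ℂ) : Matrix (Fin 4) (Fin 4) ℂ :=
  formJ ℂ * Xᴴ * formJ ℂ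

theorem formJ_mul_self : formJ ℂ * formJ ℂ = 1 := by
  ext i j
  fin_cases i <;> fin_cases j <;> simp [formJ, Matrix.mul_apply, Fin.sum_univ_succ]

theorem formJ_conjTranspose : (formJ ℂ)ᴴ = formJ ℂ := by
  ext i j
  fin_cases i <;> fin_cases j <;> simp [formJ]

theorem hermForm_mulVec_left (X : Matrix (Fin 4) (Fin 4) ℂ) (x y : Fin 4 → ℂ) :
    β (X *ᵥ x) y = β x (hermAdjoint X *ᵥ y) := by
  simp only [hermForm, hermAdjoint, star_mulVec, conjTranspose_mul, conjTranspose_conjTranspose,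
    formJ_conjTranspose]
  rw [← dotProduct_mulVec, mulVec_mulVec, mulVec_mulVec]
  simp only [← Matrix.mul_assoc]
  simp only [Matrix.mul_assoc, formJ_mul_self, Matrix.mul_one]

theorem hermForm_mulVec_right (X : Matrix (Fin 4) (Fin 4) ℂ) (x y : Fin 4 → ℂ) :
    β x (X *ᵥ y) = β (hermAdjoint X *ᵥ x) y := by
  rw [← conj_hermForm, hermForm_mulVec_left, conj_hermForm]

theorem hermAdjoint_add (X Y : Matrix (Fin 4) (Fin 4) ℂ) :
    hermAdjoint (X + Y) = hermAdjoint X + hermAdjoint Y := by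
  simp [hermAdjoint, Matrix.mul_add, Matrix.add_mul]

theorem hermAdjoint_smul (c : ℂ) (X : Matrix (Fin 4) (Fin 4) ℂ) :
    hermAdjoint (c • X) = conj c • hermAdjoint X := by
  simp [hermAdjoint]

/-- The rank one operator `x ↦ ⟨x, v⟩ u`. -/
def rankOne (u v : Fin 4 → ℂ) : Matrix (Fin 4) (Fin 4) ℂ :=
  vecMulVec u (star v ᵥ* formJ ℂ)

@[simp] theorem rankOne_mulVec (u v x : Fin 4 → ℂ) : rankOne u v *ᵥ x = β x v • u := by
  rw [rankOne, vecMulVec_mulVec, hermForm, dotProduct_mulVec]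
  simp

theorem trace_mul_rankOne (X : Matrix (Fin 4) (Fin 4) ℂ) (u v : Fin 4 → ℂ) :
    (X * rankOne u v).trace = β (X *ᵥ u) v := by
  rw [rankOne, mul_vecMulVec, trace_vecMulVec, hermForm, dotProduct_mulVec, dotProduct_comm]

theorem Matrix.ext_mulVec {X Y : Matrix (Fin 4) (Fin 4) ℂ} (h : ∀ x, X *ᵥ x = Y *ᵥ x) : X = Y := by
  ext i j
  simpa using congrFun (h (Pi.single j 1)) i

theorem hermAdjoint_rankOne (u v : Fin 4 → ℂ) : hermAdjoint (rankOne u v) = rankOne v u := by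
  refine Matrix.ext_mulVec fun x => ?_
  rw [← sub_eq_zero]
  refine hermForm_nondegenerate fun y => ?_
  rw [← conj_hermForm, hermForm_sub_right, ← hermForm_mulVec_left]
  simp [conj_hermForm, mul_comm]

theorem hermForm_mulVec_mulVec {γ : Matrix.SpecialLinearGroup (Fin 4) ℂ} (hγ : γ ∈ SU31)
    (x y : Fin 4 → ℂ) : β (γ.val *ᵥ x) (γ.val *ᵥ y) = β x y := by
  have h : γ.valᴴ * formJ ℂ * γ.val = formJ ℂ := hγ
  simp only [hermForm, star_mulVec]
  rw [← dotProduct_mulVec, mulVec_mulVec, mulVec_mulVec, h]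

theorem hermAdjoint_of_mem {γ : Matrix.SpecialLinearGroup (Fin 4) ℂ} (hγ : γ ∈ SU31) :
    hermAdjoint γ.val = (γ⁻¹).val := by
  have h : γ.valᴴ * formJ ℂ * γ.val = formJ ℂ := hγ
  have h' : γ.val * (γ⁻¹).val = 1 := congrArg Subtype.val (mul_inv_cancel γ)
  calc hermAdjoint γ.val = formJ ℂ * (γ.valᴴ * formJ ℂ * γ.val) * (γ⁻¹).val := by
        rw [hermAdjoint]; simp only [Matrix.mul_assoc, h', Matrix.mul_one]
    _ = _ := by rw [h, formJ_mul_self, Matrix.one_mul]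

/-- The orthogonal complement of a subspace for the Hermitian form. -/
def hermOrthogonal (U : Submodule ℂ (Fin 4 → ℂ)) : Submodule ℂ (Fin 4 → ℂ) where
  carrier := {x | ∀ y ∈ U, β x y = 0}
  add_mem' hx hx' y hy := by simp [hx y hy, hx' y hy]
  zero_mem' y _ := by simp
  smul_mem' c x hx y hy := by simp [hx y hy]

/-- The linear map of products with finitely many given vectors. -/
def hermFormMap {ι : Type*} (v : ι → Fin 4 → ℂ) : (Fin 4 → ℂ) →ₗ[ℂ] ι → ℂ where
  toFun x i := β x (v i)
  map_add' x y := by ext; simp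
  map_smul' c x := by ext; simp

theorem exists_orthogonal_mem {ι : Type*} [Fintype ι] (v : ι → Fin 4 → ℂ)
    {U : Submodule ℂ (Fin 4 → ℂ)} (h : Fintype.card ι < Module.finrank ℂ U) :
    ∃ x ∈ U, x ≠ 0 ∧ ∀ i, β x (v i) = 0 := by
  have hk : LinearMap.ker ((hermFormMap v).domRestrict U) ≠ ⊥ :=
    LinearMap.ker_ne_bot_of_finrank_lt (by simpa using h)
  obtain ⟨x, hx, hx0⟩ := Submodule.exists_mem_ne_zero_of_ne_bot hk
  exact ⟨x, x.2, fun h => hx0 (Subtype.ext h), fun i => congrFun (LinearMap.mem_ker.mp hx) i⟩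

theorem isCompl_hermOrthogonal {U : Submodule ℂ (Fin 4 → ℂ)} (hU : U ⊓ hermOrthogonal U = ⊥) :
    IsCompl U (hermOrthogonal U) := by
  refine ⟨disjoint_iff.mpr hU, codisjoint_iff.mpr ?_⟩
  let b := Module.finBasis ℂ U
  have hker : LinearMap.ker (hermFormMap fun i => (b i : Fin 4 → ℂ)) ≤ hermOrthogonal U := by
    intro x hx y hy
    have hs : ∀ z : U, β x z = 0 := fun z => by
      induction b.mem_span z using Submodule.span_induction with
      | mem z hz =>
        obtain ⟨i, rfl⟩ := hz
        exact congrFun (LinearMap.mem_ker.mp hx) i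
      | zero => simp
      | add _ _ _ _ h₁ h₂ => simp [h₁, h₂]
      | smul c _ _ h => simp [h]
    exact hs ⟨y, hy⟩
  have h1 := LinearMap.finrank_range_add_finrank_ker (hermFormMap fun i => (b i : Fin 4 → ℂ))
  have h2 := Submodule.finrank_le (LinearMap.range (hermFormMap fun i => (b i : Fin 4 → ℂ)))
  have h3 := Submodule.finrank_mono hker
  have h4 := Submodule.finrank_sup_add_finrank_inf_eq U (hermOrthogonal U)
  rw [hU, finrank_bot] at h4
  simp only [Module.finrank_fin_fun] at h1 h2
  refine Submodule.eq_top_of_finrank_eq (le_antisymm (Submodule.finrank_le _) ?_)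
  rw [Module.finrank_fin_fun]
  omega

theorem isElementary_of_finite_lines {Γ : Subgroup (Matrix.SpecialLinearGroup (Fin 4) ℂ)}
    {x : Fin 4 → ℂ} (hx0 : x ≠ 0) (hx : (β x x).re ≤ 0) {F : Set (Fin 4 → ℂ)} (hF : F.Finite)
    (h : ∀ γ ∈ Γ, ∃ y ∈ F, ∃ c : ℂ, γ.val *ᵥ x = c • y) : IsElementary Γ := by
  classical
  refine ⟨Projectivization.mk ℂ x hx0, ?_, ?_⟩
  · obtain ⟨a, ha⟩ := Projectivization.exists_smul_eq_mk_rep ℂ x hx0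
    have : (β (Projectivization.mk ℂ x hx0).rep (Projectivization.mk ℂ x hx0).rep).re ≤ 0 := by
      rw [← ha, Units.smul_def, hermForm_self_smul_re]
      exact mul_nonpos_of_nonneg_of_nonpos (Complex.normSq_nonneg _) hx
    rcases this.lt_or_eq with h | h
    · exact Or.inl h
    · exact Or.inr h
  · refine (hF.image fun y => if hy : y ≠ 0 then Projectivization.mk ℂ y hy
      else Projectivization.mk ℂ x hx0).subset ?_
    rintro _ ⟨γ, rfl⟩
    obtain ⟨y, hyF, c, hc⟩ := h γ γ.2
    have hne : γ.1.val *ᵥ x ≠ 0 := (smul_ne_zero_iff_ne γ.1).mpr hx0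
    have hy : y ≠ 0 := by
      rintro rfl
      exact hne (by rw [hc, smul_zero])
    refine ⟨y, hyF, ?_⟩
    refine (dif_pos hy).trans ?_
    have hc0 : c ≠ 0 := by
      rintro rfl
      exact hne (by rw [hc, zero_smul])
    refine (Projectivization.mk_eq_mk_iff' ℂ y (γ.1.val *ᵥ x) hy hne).mpr ⟨c⁻¹, ?_⟩
    rw [hc, smul_smul, inv_mul_cancel₀ hc0, one_smul]

/-- A subspace of `ℂ⁴` is invariant under a group of matrices. -/
def IsInvariantSubspace (Γ : Subgroup (Matrix.SpecialLinearGroup (Fin 4) ℂ))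
    (U : Submodule ℂ (Fin 4 → ℂ)) : Prop :=
  ∀ γ ∈ Γ, ∀ x ∈ U, γ.val *ᵥ x ∈ U

section

variable {Γ : Subgroup (Matrix.SpecialLinearGroup (Fin 4) ℂ)}

theorem IsInvariantSubspace.orthogonal (hΓ : Γ ≤ SU31)
    {U : Submodule ℂ (Fin 4 → ℂ)} (hU : IsInvariantSubspace Γ U) :
    IsInvariantSubspace Γ (hermOrthogonal U) := by
  intro γ hγ x hx y hy
  rw [hermForm_mulVec_left, hermAdjoint_of_mem (hΓ hγ)]
  exact hx _ (hU _ (Γ.inv_mem hγ) y hy)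

theorem IsInvariantSubspace.inf_orthogonal (hΓ : Γ ≤ SU31)
    (hne : ¬ IsElementary Γ) {U : Submodule ℂ (Fin 4 → ℂ)}
    (hU : IsInvariantSubspace Γ U) : U ⊓ hermOrthogonal U = ⊥ := by
  by_contra hbot
  obtain ⟨x, hx, hx0⟩ := Submodule.exists_mem_ne_zero_of_ne_bot hbot
  have hnull : ∀ y ∈ U ⊓ hermOrthogonal U, ∀ z ∈ U ⊓ hermOrthogonal U, β y z = 0 :=
    fun y hy z hz => hy.2 z hz.1
  refine hne (isElementary_of_finite_lines hx0 (by simp [hnull x hx x hx])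
    (Set.finite_singleton x) fun γ hγ => ⟨x, rfl, ?_⟩)
  have hγx : γ.val *ᵥ x ∈ U ⊓ hermOrthogonal U :=
    ⟨hU γ hγ x hx.1, hU.orthogonal hΓ γ hγ x hx.2⟩
  exact exists_smul_of_hermForm_nonpos hx0 (by simp [hnull x hx x hx])
    (by simp [hnull _ hγx _ hγx]) (hnull x hx _ hγx)

/-- An irreducible invariant subspace of `ℂ⁴` on which the Hermitian form is nondegenerate and
takes negative values. -/
structure IsHyperbolicCore (Γ : Subgroup (Matrix.SpecialLinearGroup (Fin 4) ℂ))
    (W : Submodule ℂ (Fin 4 → ℂ)) : Prop where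
  le : Γ ≤ SU31
  invariant : IsInvariantSubspace Γ W
  irreducible : ∀ U ≤ W, IsInvariantSubspace Γ U → U = ⊥ ∨ U = W
  exists_neg : ∃ n ∈ W, (β n n).re < 0
  isCompl : IsCompl W (hermOrthogonal W)
  two_le : 2 ≤ Module.finrank ℂ W

theorem exists_isHyperbolicCore (hΓ : Γ ≤ SU31) (hne : ¬ IsElementary Γ) :
    ∃ W, IsHyperbolicCore Γ W := by
  let S : Set (Submodule ℂ (Fin 4 → ℂ)) := {W | IsInvariantSubspace Γ W ∧ ∃ n ∈ W, (β n n).re < 0}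
  have hS : S.Nonempty := ⟨⊤, fun _ _ _ _ => trivial, Pi.single 0 1 - Pi.single 3 1, trivial, by
    simp [hermForm_apply]⟩
  obtain ⟨W, ⟨hW, n, hn, hneg⟩, hmin⟩ := wellFounded_lt.has_min S hS
  have hcompl := fun {U} (hU : IsInvariantSubspace Γ U) =>
    isCompl_hermOrthogonal (hU.inf_orthogonal hΓ hne)
  have hle : ∀ U ≤ W, U ∈ S → U = W := fun U hUW hU => by
    by_contra h
    exact hmin U hU (lt_of_le_of_ne hUW h)
  refine ⟨W, hΓ, hW, fun U hUW hU => ?_, ⟨n, hn, hneg⟩, hcompl hW, ?_⟩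
  · obtain ⟨u, hu, u', hu', huu⟩ : ∃ u ∈ U, ∃ u' ∈ hermOrthogonal U, u + u' = n :=
      Submodule.mem_sup.mp ((hcompl hU).sup_eq_top ▸ Submodule.mem_top)
    have hsum : (β n n).re = (β u u).re + (β u' u').re := by
      rw [← huu]
      simp [hu' u hu, hermForm_eq_zero_comm (hu' u hu)]
    by_cases h : (β u u).re < 0
    · exact Or.inr (hle U hUW ⟨hU, u, hu, h⟩)
    · have hu'W : u' ∈ W := by
        rw [← eq_sub_iff_add_eq'] at huu
        exact huu ▸ W.sub_mem hn (hUW hu)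
      have := hle (W ⊓ hermOrthogonal U) inf_le_left
        ⟨fun γ hγ x hx => ⟨hW γ hγ x hx.1, hU.orthogonal hΓ γ hγ x hx.2⟩, u', ⟨hu'W, hu'⟩,
          by linarith⟩
      left
      rw [← hU.inf_orthogonal hΓ hne, eq_comm]
      exact inf_eq_left.mpr (hUW.trans (inf_eq_left.mp this))
  · by_contra hlt
    have hn0 := ne_zero_of_hermForm_neg hneg
    refine hne (isElementary_of_finite_lines hn0 hneg.le
      (Set.finite_singleton n) fun γ hγ => ⟨n, rfl, ?_⟩)
    have h1 : Module.finrank ℂ W ≤ 1 := by omega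
    obtain ⟨v, hv⟩ := finrank_le_one_iff.mp h1
    obtain ⟨a, ha⟩ := hv ⟨n, hn⟩
    obtain ⟨b, hb⟩ := hv ⟨_, hW γ hγ n hn⟩
    have ha' : a • (v : Fin 4 → ℂ) = n := congrArg Subtype.val ha
    have hb' : b • (v : Fin 4 → ℂ) = γ.val *ᵥ n := congrArg Subtype.val hb
    have ha0 : a ≠ 0 := by
      rintro rfl
      exact hn0 (by rw [← ha', zero_smul])
    refine ⟨b / a, ?_⟩
    rw [← hb', ← ha', smul_smul, div_mul_cancel₀ _ ha0]

end

/-- `ConjPair Γ X Y` holds if there are coefficients `c` with `X = ∑ c γ • γ` and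
`Y = ∑ conj (c γ) • γ`, the sums running over finitely many elements of `Γ`. -/
inductive ConjPair (Γ : Subgroup (Matrix.SpecialLinearGroup (Fin 4) ℂ)) :
    Matrix (Fin 4) (Fin 4) ℂ → Matrix (Fin 4) (Fin 4) ℂ → Prop
  | of {γ} : γ ∈ Γ → ConjPair Γ γ.val γ.val
  | add {X Y X' Y'} : ConjPair Γ X Y → ConjPair Γ X' Y' → ConjPair Γ (X + X') (Y + Y')
  | smul (c : ℂ) {X Y} : ConjPair Γ X Y → ConjPair Γ (c • X) (conj c • Y)

namespace ConjPair

variable {Γ : Subgroup (Matrix.SpecialLinearGroup (Fin 4) ℂ)}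
  {X Y X' Y' : Matrix (Fin 4) (Fin 4) ℂ}

theorem one : ConjPair Γ 1 1 := of Γ.one_mem

theorem zero : ConjPair Γ 0 0 := by simpa using one.smul (Γ := Γ) 0

theorem symm (h : ConjPair Γ X Y) : ConjPair Γ Y X := by
  induction h with
  | of h => exact of h
  | add _ _ h h' => exact h.add h'
  | smul c _ h => simpa using h.smul (conj c)

theorem sub (h : ConjPair Γ X Y) (h' : ConjPair Γ X' Y') : ConjPair Γ (X - X') (Y - Y') := by
  simpa [sub_eq_add_neg] using h.add (h'.smul (-1))

theorem mul (h : ConjPair Γ X Y) (h' : ConjPair Γ X' Y') : ConjPair Γ (X * X') (Y * Y') := by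
  induction h with
  | of hγ =>
    induction h' with
    | of hδ => exact of (Γ.mul_mem hγ hδ)
    | add _ _ h h' => simpa [Matrix.mul_add] using h.add h'
    | smul c _ h => simpa using h.smul c
  | add _ _ h h' => simpa [Matrix.add_mul] using h.add h'
  | smul c _ h => simpa using h.smul c

theorem hermAdjoint (hΓ : Γ ≤ SU31) (h : ConjPair Γ X Y) :
    ConjPair Γ (hermAdjoint X) (hermAdjoint Y) := by
  induction h with
  | of h => rw [hermAdjoint_of_mem (hΓ h)]; exact of (Γ.inv_mem h)
  | add _ _ h h' => simpa [hermAdjoint_add] using h.add h'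
  | smul c _ h => simpa [hermAdjoint_smul] using h.smul (conj c)

theorem mulVec_mem (h : ConjPair Γ X Y) {U : Submodule ℂ (Fin 4 → ℂ)} (hU : IsInvariantSubspace Γ U)
    {x : Fin 4 → ℂ} (hx : x ∈ U) : X *ᵥ x ∈ U := by
  induction h with
  | of h => exact hU _ h x hx
  | add _ _ h h' => rw [add_mulVec]; exact U.add_mem h h'
  | smul c _ h => rw [smul_mulVec]; exact U.smul_mem c h

theorem trace (htr : ∀ γ ∈ Γ, ∃ x : ℝ, (γ : Matrix (Fin 4) (Fin 4) ℂ).trace = (x : ℂ))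
    (h : ConjPair Γ X Y) : Y.trace = conj X.trace := by
  induction h with
  | of h => obtain ⟨x, hx⟩ := htr _ h; simp [hx]
  | add _ _ h h' => simp [h, h']
  | smul c _ h => simp [h]

end ConjPair

/-- The enveloping algebra of a group of matrices. -/
def envelopingAlgebra (Γ : Subgroup (Matrix.SpecialLinearGroup (Fin 4) ℂ)) :
    Subalgebra ℂ (Matrix (Fin 4) (Fin 4) ℂ) where
  carrier := {X | ∃ Y, ConjPair Γ X Y}
  mul_mem' := fun ⟨_, h⟩ ⟨_, h'⟩ => ⟨_, h.mul h'⟩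
  add_mem' := fun ⟨_, h⟩ ⟨_, h'⟩ => ⟨_, h.add h'⟩
  algebraMap_mem' c := ⟨_, by
    rw [Algebra.algebraMap_eq_smul_one]
    exact ConjPair.one.smul c⟩

/-- **Burnside's theorem**: an algebra of endomorphisms of a finite-dimensional vector space over
an algebraically closed field that has no proper invariant subspace consists of all
endomorphisms. -/
theorem Subalgebra.eq_top_of_irreducible {k V : Type*} [Field k] [IsAlgClosed k] [AddCommGroup V]
    [Module k V] [FiniteDimensional k V] [Nontrivial V] (A : Subalgebra k (Module.End k V))
    (hA : ∀ U : Submodule k V, (∀ a ∈ A, ∀ u ∈ U, a u ∈ U) → U = ⊥ ∨ U = ⊤) : A = ⊤ := by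
  have hsimple : IsSimpleModule A V := by
    rw [isSimpleModule_iff_toSpanSingleton_surjective]
    refine ⟨inferInstance, fun v hv w => ?_⟩
    have hU := hA ((LinearMap.range (LinearMap.toSpanSingleton A V v)).restrictScalars k) (by
      rintro a ha _ ⟨b, rfl⟩
      exact ⟨⟨a, ha⟩ * b, by simp [mul_smul]; rfl⟩)
    rcases hU with hU | hU
    · exact absurd (show v ∈ (⊥ : Submodule k V) from hU ▸ ⟨1, by simp⟩) (by simpa using hv)
    · exact (hU.symm ▸ trivial : w ∈ (LinearMap.range
        (LinearMap.toSpanSingleton A V v)).restrictScalars k)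
  have hbij := IsSimpleModule.algebraMap_end_bijective_of_isAlgClosed k (A := A) (V := V)
  rw [eq_top_iff]
  intro f _
  let F : Module.End (Module.End A V) V :=
    { toFun := f
      map_add' := f.map_add
      map_smul' := fun e v => by
        obtain ⟨t, rfl⟩ := hbij.2 e
        simp }
  obtain ⟨s, hs⟩ := Module.Finite.fg_top (R := k) (M := V)
  obtain ⟨r, hr⟩ := jacobson_density F s
  have : f = r := by
    refine LinearMap.ext_on hs fun m hm => ?_
    exact hr m hm
  exact this ▸ r.2

theorem exists_real_smul_hermForm {x : Fin 4 → ℂ} {s : ℝ} (h : 0 < (β x x).re * s) :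
    ∃ r : ℝ, β ((r : ℂ) • x) ((r : ℂ) • x) = ((SignType.sign s : ℝ) : ℂ) := by
  have hs : (SignType.sign s : ℝ) = SignType.sign (β x x).re := by
    rcases pos_and_pos_or_neg_and_neg_of_mul_pos h with ⟨h1, h2⟩ | ⟨h1, h2⟩
    · simp [sign_pos h1, sign_pos h2]
    · simp [sign_neg h1, sign_neg h2]
  have h0 : (β x x).re ≠ 0 := fun h0 => by simp [h0] at h
  refine ⟨1 / √|(β x x).re|, ?_⟩
  rw [hermForm_self_eq_re, hermForm_self_smul_re, Complex.normSq_ofReal, hs]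
  congr 1
  rw [div_mul_div_comm, Real.mul_self_sqrt (abs_nonneg _), one_mul, one_div, inv_mul_eq_div,
    div_eq_iff (abs_ne_zero.mpr h0), sign_mul_abs]

theorem exists_real_smul_hermForm_eq_one {x : Fin 4 → ℂ} (h : 0 < (β x x).re) :
    ∃ r : ℝ, β ((r : ℂ) • x) ((r : ℂ) • x) = 1 := by
  simpa using exists_real_smul_hermForm (s := 1) (x := x) (by simpa using h)

theorem exists_real_smul_hermForm_eq_neg_one {x : Fin 4 → ℂ} (h : (β x x).re < 0) :
    ∃ r : ℝ, β ((r : ℂ) • x) ((r : ℂ) • x) = -1 := by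
  simpa using exists_real_smul_hermForm (s := -1) (x := x) (by simpa using h)

/-- A sequence of four pairwise orthogonal vectors of norms `-1, 1, 1, 1`. -/
structure IsFrame (v : Fin 4 → Fin 4 → ℂ) : Prop where
  neg : β (v 0) (v 0) = -1
  pos : ∀ i, i ≠ 0 → β (v i) (v i) = 1
  orthogonal : ∀ i j, i ≠ j → β (v i) (v j) = 0

theorem exists_isFrame (C : Fin 4 → Set (Fin 4 → ℂ))
    (hC : ∀ i, ∀ x ∈ C i, ∀ r : ℝ, (r : ℂ) • x ∈ C i) (h0 : ∃ n ∈ C 0, (β n n).re < 0)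
    (h : ∀ i, i ≠ 0 → ∀ v : Fin 4 → Fin 4 → ℂ, (∀ j < i, v j ∈ C j) →
      ∃ x ∈ C i, x ≠ 0 ∧ ∀ j < i, β x (v j) = 0) :
    ∃ v, IsFrame v ∧ ∀ i, v i ∈ C i := by
  obtain ⟨n, hnC, hneg⟩ := h0
  obtain ⟨r, hr⟩ := exists_real_smul_hermForm_eq_neg_one hneg
  set v0 := (r : ℂ) • n
  have hv0 : v0 ∈ C 0 := hC 0 n hnC r
  have step : ∀ i, i ≠ 0 → ∀ v : Fin 4 → Fin 4 → ℂ, v 0 = v0 → (∀ j < i, v j ∈ C j) →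
      ∃ x ∈ C i, β x x = 1 ∧ ∀ j < i, β x (v j) = 0 := by
    intro i hi v hv hvC
    obtain ⟨x, hxC, hx0, hx⟩ := h i hi v hvC
    have hx0' := hx 0 (Fin.pos_of_ne_zero hi)
    rw [hv] at hx0'
    obtain ⟨s, hs⟩ := exists_real_smul_hermForm_eq_one
      (hermForm_pos_of_orthogonal (x := v0) (by simp [hr]) (hermForm_eq_zero_comm hx0') hx0)
    exact ⟨_, hC i x hxC s, hs, fun j hj => by
      rw [hermForm_smul_left, hx j hj, mul_zero]⟩
  obtain ⟨v1, h1C, h1, h10⟩ := step 1 (by decide) ![v0, 0, 0, 0] rfl (by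
    intro j hj; fin_cases j <;> first | assumption | exact absurd hj (by decide))
  obtain ⟨v2, h2C, h2, h20⟩ := step 2 (by decide) ![v0, v1, 0, 0] rfl (by
    intro j hj; fin_cases j <;> first | assumption | exact absurd hj (by decide))
  obtain ⟨v3, h3C, h3, h30⟩ := step 3 (by decide) ![v0, v1, v2, 0] rfl (by
    intro j hj; fin_cases j <;> first | assumption | exact absurd hj (by decide))
  have e10 : β v1 v0 = 0 := h10 0 (by decide)
  have e20 : β v2 v0 = 0 := h20 0 (by decide)
  have e21 : β v2 v1 = 0 := h20 1 (by decide)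
  have e30 : β v3 v0 = 0 := h30 0 (by decide)
  have e31 : β v3 v1 = 0 := h30 1 (by decide)
  have e32 : β v3 v2 = 0 := h30 2 (by decide)
  have e01 := hermForm_eq_zero_comm e10
  have e02 := hermForm_eq_zero_comm e20
  have e12 := hermForm_eq_zero_comm e21
  have e03 := hermForm_eq_zero_comm e30
  have e13 := hermForm_eq_zero_comm e31
  have e23 := hermForm_eq_zero_comm e32
  refine ⟨![v0, v1, v2, v3], ⟨hr, ?_, ?_⟩, ?_⟩
  · intro i hi
    fin_cases i <;> first | assumption | exact absurd rfl hi
  · intro i j hij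
    fin_cases i <;> fin_cases j <;> first | assumption | exact absurd rfl hij
  · intro i
    fin_cases i <;> assumption

namespace IsFrame

variable {v : Fin 4 → Fin 4 → ℂ}

/-- Any vector is the combination of the vectors of a frame given by its products with them. -/
theorem eq_sum (hv : IsFrame v) (x : Fin 4 → ℂ) :
    x = -β x (v 0) • v 0 + β x (v 1) • v 1 + β x (v 2) • v 2 + β x (v 3) • v 3 := by
  have hli : LinearIndependent ℂ v := by
    rw [Fintype.linearIndependent_iff]
    intro g hg i
    have : β (∑ j, g j • v j) (v i) = g i * β (v i) (v i) := by
      simp only [Fin.sum_univ_four, hermForm_add_left, hermForm_smul_left]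
      fin_cases i <;> simp [hv.orthogonal]
    rw [hg, hermForm_zero_left, eq_comm, mul_eq_zero] at this
    rcases this with h | h
    · exact h
    · exfalso
      by_cases hi : i = 0
      · rw [hi, hv.neg] at h
        norm_num at h
      · rw [hv.pos i hi] at h
        norm_num at h
  have hspan := hli.span_eq_top_of_card_eq_finrank (by simp)
  obtain ⟨c, rfl⟩ := (Submodule.mem_span_range_iff_exists_fun ℂ).mp
    (hspan ▸ Submodule.mem_top (x := x))
  simp [Fin.sum_univ_four, hv.neg, hv.pos, hv.orthogonal]

theorem trace_eq (hv : IsFrame v) (X : Matrix (Fin 4) (Fin 4) ℂ) :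
    X.trace = -β (X *ᵥ v 0) (v 0) + β (X *ᵥ v 1) (v 1) + β (X *ᵥ v 2) (v 2)
      + β (X *ᵥ v 3) (v 3) := by
  have h1 : (1 : Matrix (Fin 4) (Fin 4) ℂ) = -rankOne (v 0) (v 0) + rankOne (v 1) (v 1)
      + rankOne (v 2) (v 2) + rankOne (v 3) (v 3) := by
    refine Matrix.ext_mulVec fun x => ?_
    simp only [one_mulVec, add_mulVec, neg_mulVec, rankOne_mulVec, ← neg_smul]
    exact hv.eq_sum x
  conv_lhs => rw [← Matrix.mul_one X, h1]
  simp [Matrix.mul_add, trace_mul_rankOne]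

end IsFrame

theorem exists_isFrame_of_neg {n : Fin 4 → ℂ} (hn : (β n n).re < 0) :
    ∃ v, IsFrame v ∧ ∃ c : ℂ, v 0 = c • n := by
  obtain ⟨v, hv, hvC⟩ := exists_isFrame
    (fun i => {x | i = 0 → ∃ c : ℂ, x = c • n})
    (fun i x hx r h => by
      obtain ⟨c, rfl⟩ := hx h
      exact ⟨r * c, smul_smul _ _ _⟩)
    ⟨n, fun _ => ⟨1, by simp⟩, hn⟩
    (fun i hi v _ => by
      obtain ⟨x, -, hx0, hx⟩ := exists_orthogonal_mem (U := ⊤) (fun j : Fin i => v (j.castLE i.2.le))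
        (by simp)
      exact ⟨x, fun h => absurd h hi, hx0, fun j hj => hx ⟨j, hj⟩⟩)
  exact ⟨v, hv, hvC 0 rfl⟩

theorem aeval_mulVec_of_mulVec_eq_smul {X : Matrix (Fin 4) (Fin 4) ℂ} {x : Fin 4 → ℂ} {c : ℂ}
    (h : X *ᵥ x = c • x) (q : Polynomial ℂ) : Polynomial.aeval X q *ᵥ x = q.eval c • x := by
  induction q using Polynomial.induction_on with
  | C a => simp [Algebra.algebraMap_eq_smul_one, smul_mulVec]
  | add p q hp hq => rw [map_add, add_mulVec, hp, hq, Polynomial.eval_add, add_smul]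
  | monomial k a ih =>
    rw [pow_succ, ← mul_assoc, map_mul, Polynomial.aeval_X, ← mulVec_mulVec, h, mulVec_smul, ih,
      smul_smul, mul_comm c, Polynomial.eval_mul_X]

namespace IsHyperbolicCore

variable {Γ : Subgroup (Matrix.SpecialLinearGroup (Fin 4) ℂ)} {W : Submodule ℂ (Fin 4 → ℂ)}
  {X Y Z : Matrix (Fin 4) (Fin 4) ℂ}

theorem exists_eq_neg_one (hW : IsHyperbolicCore Γ W) : ∃ n ∈ W, β n n = -1 := by
  obtain ⟨n, hn, hneg⟩ := hW.exists_neg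
  obtain ⟨r, hr⟩ := exists_real_smul_hermForm_eq_neg_one hneg
  exact ⟨_, W.smul_mem _ hn, hr⟩

theorem exists_eq_one (hW : IsHyperbolicCore Γ W) : ∃ p ∈ W, β p p = 1 := by
  obtain ⟨n, hn, hneg⟩ := hW.exists_neg
  obtain ⟨x, hx, hx0, hxn⟩ := exists_orthogonal_mem (U := W) ![n]
    (by have := hW.two_le; rw [Fintype.card_fin]; omega)
  obtain ⟨r, hr⟩ := exists_real_smul_hermForm_eq_one
    (hermForm_pos_of_orthogonal hneg (hermForm_eq_zero_comm (hxn 0)) hx0)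
  exact ⟨_, W.smul_mem _ hx, hr⟩

theorem pos_of_mem_orthogonal (hW : IsHyperbolicCore Γ W) {x : Fin 4 → ℂ}
    (hx : x ∈ hermOrthogonal W) (hx0 : x ≠ 0) : 0 < (β x x).re := by
  obtain ⟨n, hn, hneg⟩ := hW.exists_neg
  exact hermForm_pos_of_orthogonal hneg (hermForm_eq_zero_comm (hx n hn)) hx0

theorem eq_zero_of_orthogonal (hW : IsHyperbolicCore Γ W) {x : Fin 4 → ℂ} (hx : x ∈ W)
    (h : ∀ y ∈ W, β x y = 0) : x = 0 :=
  Submodule.disjoint_def.mp hW.isCompl.disjoint x hx h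

theorem ext_mulVec (hW : IsHyperbolicCore Γ W) (h : ∀ x ∈ W, X *ᵥ x = Y *ᵥ x)
    (h' : ∀ x ∈ hermOrthogonal W, X *ᵥ x = Y *ᵥ x) : X = Y := by
  refine Matrix.ext_mulVec fun x => ?_
  obtain ⟨y, hy, z, hz, rfl⟩ := Submodule.mem_sup.mp
    (hW.isCompl.sup_eq_top ▸ Submodule.mem_top (x := x))
  rw [mulVec_add, mulVec_add, h y hy, h' z hz]

theorem exists_mulVec_eq (hW : IsHyperbolicCore Γ W) (f : Module.End ℂ W) :
    ∃ X ∈ envelopingAlgebra Γ, ∀ x : W, X *ᵥ x = f x := by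
  let A : Subalgebra ℂ (Module.End ℂ W) :=
    { carrier := {f | ∃ X ∈ envelopingAlgebra Γ, ∀ x : W, X *ᵥ x = f x}
      mul_mem' := fun ⟨X, hX, h⟩ ⟨X', hX', h'⟩ => ⟨X * X', mul_mem hX hX', fun x => by
        rw [← mulVec_mulVec, h', h, Module.End.mul_apply]⟩
      add_mem' := fun ⟨X, hX, h⟩ ⟨X', hX', h'⟩ => ⟨X + X', add_mem hX hX', fun x => by
        rw [add_mulVec, h', h, LinearMap.add_apply, Submodule.coe_add]⟩
      algebraMap_mem' := fun c => ⟨algebraMap ℂ _ c, Subalgebra.algebraMap_mem _ c, fun x => by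
        simp [Algebra.algebraMap_eq_smul_one, smul_mulVec]⟩ }
  have hnt : Nontrivial W := Module.nontrivial_of_finrank_pos (R := ℂ)
    (by have := hW.two_le; omega)
  have hA : A = ⊤ := A.eq_top_of_irreducible fun U hU => by
    have hinv : IsInvariantSubspace Γ (U.map W.subtype) := by
      rintro γ hγ _ ⟨u, hu, rfl⟩
      let f : Module.End ℂ W := (mulVecLin γ.val).restrict (p := W) (q := W)
        (fun x hx => hW.invariant γ hγ x hx)
      exact ⟨f u, hU f ⟨_, ⟨_, ConjPair.of hγ⟩, fun x => rfl⟩ u hu, rfl⟩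
    rcases hW.irreducible _ (Submodule.map_subtype_le W U) hinv with h | h
    · left
      apply Submodule.map_injective_of_injective W.subtype_injective
      simpa using h
    · right
      apply Submodule.map_injective_of_injective W.subtype_injective
      simpa using h
  have hf : f ∈ A := hA ▸ Algebra.mem_top
  exact hf

/-- The operator `x ↦ ⟨x, v⟩ u` on an irreducible subspace is induced by the enveloping algebra. -/
theorem exists_mulVec_eq_smul (hW : IsHyperbolicCore Γ W) {u : Fin 4 → ℂ} (hu : u ∈ W)
    (v : Fin 4 → ℂ) : ∃ X ∈ envelopingAlgebra Γ, ∀ x ∈ W, X *ᵥ x = β x v • u := by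
  obtain ⟨X, hX, h⟩ := hW.exists_mulVec_eq ((mulVecLin (rankOne u v)).restrict (p := W) (q := W)
    (fun x _ => by simpa using W.smul_mem _ hu))
  exact ⟨X, hX, fun x hx => by simpa using h ⟨x, hx⟩⟩

theorem hermAdjoint_mem (hW : IsHyperbolicCore Γ W) (hX : X ∈ envelopingAlgebra Γ) :
    hermAdjoint X ∈ envelopingAlgebra Γ := by
  obtain ⟨Y, hY⟩ := hX
  exact ⟨_, hY.hermAdjoint hW.le⟩

theorem mulVec_mem (hW : IsHyperbolicCore Γ W) (hX : X ∈ envelopingAlgebra Γ) {x : Fin 4 → ℂ}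
    (hx : x ∈ W) : X *ᵥ x ∈ W := by
  obtain ⟨Y, hY⟩ := hX
  exact hY.mulVec_mem hW.invariant hx

theorem mulVec_mem_orthogonal (hW : IsHyperbolicCore Γ W) (hX : X ∈ envelopingAlgebra Γ)
    {x : Fin 4 → ℂ} (hx : x ∈ hermOrthogonal W) : X *ᵥ x ∈ hermOrthogonal W := by
  obtain ⟨Y, hY⟩ := hX
  exact hY.mulVec_mem (hW.invariant.orthogonal hW.le) hx

/-- The enveloping algebra contains an operator that kills the orthogonal complement of the core
and fixes a given negative vector. -/
theorem exists_mem_fixing_neg (hW : IsHyperbolicCore Γ W) {n : Fin 4 → ℂ} (hn : n ∈ W)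
    (hnn : β n n = -1) : ∃ c ∈ envelopingAlgebra Γ, c *ᵥ n = n ∧
      ∀ x ∈ hermOrthogonal W, c *ᵥ x = 0 := by
  obtain ⟨p, hp, hpp⟩ := hW.exists_eq_one
  obtain ⟨X, hX, hXW⟩ := hW.exists_mulVec_eq_smul hn p
  have hX' := hW.hermAdjoint_mem hX
  set b := X * hermAdjoint X with hb
  have hbA : b ∈ envelopingAlgebra Γ := mul_mem hX hX'
  have hXn : hermAdjoint X *ᵥ n = -p := by
    rw [← sub_eq_zero]
    refine hW.eq_zero_of_orthogonal (W.sub_mem (hW.mulVec_mem hX' hn) (W.neg_mem hp)) fun y hy => ?_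
    rw [← conj_hermForm, hermForm_sub_right, ← hermForm_mulVec_left, hXW y hy]
    simp [hnn]
  have hbn : b *ᵥ n = -n := by
    rw [hb, ← mulVec_mulVec, hXn, mulVec_neg, hXW p hp, hpp, one_smul]
  have hinj : ∀ x ∈ hermOrthogonal W, (b + 1) *ᵥ x = 0 → x = 0 := by
    intro x hx h
    by_contra hx0
    have hpos := hW.pos_of_mem_orthogonal hx hx0
    have h2 : (β (b *ᵥ x) x).re + (β x x).re = 0 := by
      rw [← Complex.add_re, ← hermForm_add_left]
      rw [add_mulVec, one_mulVec] at h
      simp [h]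
    rw [hb, ← mulVec_mulVec, hermForm_mulVec_left] at h2
    have h3 : 0 ≤ (β (hermAdjoint X *ᵥ x) (hermAdjoint X *ᵥ x)).re := by
      by_cases h0 : hermAdjoint X *ᵥ x = 0
      · simp [h0]
      · exact (hW.pos_of_mem_orthogonal (hW.mulVec_mem_orthogonal hX' hx) h0).le
    linarith
  obtain ⟨q, hq, hnd⟩ := Polynomial.exists_eq_pow_rootMultiplicity_mul_and_not_dvd b.charpoly
    b.charpoly_monic.ne_zero (-1)
  rw [Polynomial.dvd_iff_isRoot, Polynomial.IsRoot.def] at hnd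
  have hqA : Polynomial.aeval b q ∈ envelopingAlgebra Γ := by
    simpa using (Polynomial.aeval (⟨b, hbA⟩ : envelopingAlgebra Γ) q).2
  have hqn : Polynomial.aeval b q *ᵥ n = q.eval (-1) • n :=
    aeval_mulVec_of_mulVec_eq_smul (by rw [hbn, neg_smul, one_smul]) q
  have hqx : ∀ x ∈ hermOrthogonal W, Polynomial.aeval b q *ᵥ x = 0 := by
    intro x hx
    have hch := Matrix.aeval_self_charpoly b
    have hb1 : Polynomial.aeval b (Polynomial.X - Polynomial.C (-1 : ℂ)) = b + 1 := by simp
    rw [hq, map_mul, map_pow, hb1] at hch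
    have hch' := congrArg (fun M => M *ᵥ x) hch
    simp only [zero_mulVec, ← mulVec_mulVec] at hch'
    have hpow : ∀ k : ℕ, ∀ y ∈ hermOrthogonal W, (b + 1) ^ k *ᵥ y = 0 → y = 0 := by
      intro k
      induction k with
      | zero => intro y _ h; simpa using h
      | succ k ih =>
        intro y hy h
        rw [pow_succ, ← mulVec_mulVec] at h
        exact hinj y hy (ih _ (hW.mulVec_mem_orthogonal (add_mem hbA (one_mem _)) hy) h)
    exact hpow _ _ (hW.mulVec_mem_orthogonal hqA hx) hch'
  refine ⟨(q.eval (-1))⁻¹ • Polynomial.aeval b q, Subalgebra.smul_mem _ hqA _, ?_, ?_⟩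
  · rw [smul_mulVec, hqn, smul_smul, inv_mul_cancel₀ hnd, one_smul]
  · intro x hx
    rw [smul_mulVec, hqx x hx, smul_zero]

theorem rankOne_mem (hW : IsHyperbolicCore Γ W) {u v : Fin 4 → ℂ} (hu : u ∈ W) (hv : v ∈ W) :
    rankOne u v ∈ envelopingAlgebra Γ := by
  obtain ⟨n, hn, hnn⟩ := hW.exists_eq_neg_one
  obtain ⟨c, hc, hcn, hcx⟩ := hW.exists_mem_fixing_neg hn hnn
  obtain ⟨Y, hY, hYW⟩ := hW.exists_mulVec_eq_smul hu n
  obtain ⟨Z, hZ, hZW⟩ := hW.exists_mulVec_eq_smul hn v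
  have : rankOne u v = -(Y * c * Z) := by
    refine hW.ext_mulVec (fun x hx => ?_) fun x hx => ?_
    · rw [neg_mulVec, ← mulVec_mulVec, ← mulVec_mulVec, hZW x hx, mulVec_smul, hcn, mulVec_smul,
        hYW n hn, hnn]
      simp
    · rw [neg_mulVec, ← mulVec_mulVec, ← mulVec_mulVec, hcx _ (hW.mulVec_mem_orthogonal hZ hx)]
      simp [hx v hv]
  rw [this]
  exact neg_mem (mul_mem (mul_mem hY hc) hZ)

end IsHyperbolicCore

theorem hermForm_mulVec_hermAdjoint (X : Matrix (Fin 4) (Fin 4) ℂ) (x y : Fin 4 → ℂ) :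
    β (hermAdjoint X *ᵥ x) y = β x (X *ᵥ y) := (hermForm_mulVec_right X x y).symm

/-- A nonzero antilinear map on a subspace `W` that intertwines every element of the enveloping
algebra with its conjugate. -/
structure IsConjugation (Γ : Subgroup (Matrix.SpecialLinearGroup (Fin 4) ℂ))
    (W : Submodule ℂ (Fin 4 → ℂ)) (σ : (Fin 4 → ℂ) → Fin 4 → ℂ) : Prop where
  mem : ∀ x ∈ W, σ x ∈ W
  map_add : ∀ x ∈ W, ∀ y ∈ W, σ (x + y) = σ x + σ y
  map_smul : ∀ c : ℂ, ∀ x ∈ W, σ (c • x) = conj c • σ x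
  map_mulVec : ∀ X Y, ConjPair Γ X Y → ∀ x ∈ W, σ (X *ᵥ x) = Y *ᵥ σ x
  exists_ne_zero : ∃ x ∈ W, σ x ≠ 0

namespace IsHyperbolicCore

variable {Γ : Subgroup (Matrix.SpecialLinearGroup (Fin 4) ℂ)} {W : Submodule ℂ (Fin 4 → ℂ)}
  {X Y Z : Matrix (Fin 4) (Fin 4) ℂ} {σ : (Fin 4 → ℂ) → Fin 4 → ℂ}

theorem mulVec_eq_zero_of_conjPair_zero (hW : IsHyperbolicCore Γ W)
    (htr : ∀ γ ∈ Γ, ∃ x : ℝ, (γ : Matrix (Fin 4) (Fin 4) ℂ).trace = (x : ℂ))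
    (h : ConjPair Γ 0 Z) {x : Fin 4 → ℂ} (hx : x ∈ W) : Z *ᵥ x = 0 := by
  refine hW.eq_zero_of_orthogonal (h.symm.mulVec_mem hW.invariant hx) fun y hy => ?_
  obtain ⟨U, hU⟩ := hW.rankOne_mem hx hy
  rw [← trace_mul_rankOne, (h.mul hU.symm).trace htr]
  simp

/-- If `X` is an operator of rank one from a positive line to a negative line of the core, then its
conjugate does not vanish on the core. -/
theorem exists_mulVec_ne_zero (hW : IsHyperbolicCore Γ W)
    (htr : ∀ γ ∈ Γ, ∃ x : ℝ, (γ : Matrix (Fin 4) (Fin 4) ℂ).trace = (x : ℂ))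
    {n p : Fin 4 → ℂ} (hn : n ∈ W) (hnn : β n n = -1) (hpp : β p p = 1)
    (h : ConjPair Γ (rankOne n p) Y) : ∃ m ∈ W, Y *ᵥ m ≠ 0 := by
  by_contra! hY
  have hpair := h.mul (h.hermAdjoint hW.le)
  have htrace := hpair.trace htr
  rw [hermAdjoint_rankOne, trace_mul_rankOne, rankOne_mulVec, hpp, one_smul, hnn] at htrace
  obtain ⟨v, hv, c, hc⟩ := exists_isFrame_of_neg (n := n) (by simp [hnn])
  have hYadj : ∀ x, hermAdjoint Y *ᵥ x ∈ hermOrthogonal W := fun x y hy => by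
    rw [hermForm_mulVec_hermAdjoint, hY y hy, hermForm_zero_right]
  have hpos : ∀ x, 0 ≤ (β ((Y * hermAdjoint Y) *ᵥ x) x).re := fun x => by
    rw [← mulVec_mulVec, hermForm_mulVec_left]
    by_cases h0 : hermAdjoint Y *ᵥ x = 0
    · simp [h0]
    · exact (hW.pos_of_mem_orthogonal (hYadj x) h0).le
  have hzero : (Y * hermAdjoint Y) *ᵥ v 0 = 0 := by
    have hvW : v 0 ∈ W := hc ▸ W.smul_mem c hn
    have : hermAdjoint Y *ᵥ v 0 = 0 :=
      Submodule.disjoint_def.mp hW.isCompl.disjoint _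
        ((h.hermAdjoint hW.le).symm.mulVec_mem hW.invariant hvW) (hYadj _)
    rw [← mulVec_mulVec, this, mulVec_zero]
  rw [hv.trace_eq, hzero] at htrace
  have hre := congrArg Complex.re htrace
  simp only [Complex.add_re, hermForm_zero_left, neg_zero, zero_add, map_neg,
    map_one, Complex.neg_re, Complex.one_re] at hre
  linarith [hpos (v 1), hpos (v 2), hpos (v 3)]

theorem exists_isConjugation (hW : IsHyperbolicCore Γ W)
    (htr : ∀ γ ∈ Γ, ∃ x : ℝ, (γ : Matrix (Fin 4) (Fin 4) ℂ).trace = (x : ℂ)) :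
    ∃ σ, IsConjugation Γ W σ := by
  classical
  obtain ⟨n, hn, hnn⟩ := hW.exists_eq_neg_one
  obtain ⟨p, hp, hpp⟩ := hW.exists_eq_one
  obtain ⟨Y₀, hY₀⟩ := hW.rankOne_mem hn hp
  obtain ⟨m, hm, hw0⟩ := hW.exists_mulVec_ne_zero htr hn hnn hpp hY₀
  set w := Y₀ *ᵥ m with hw
  have hwW : w ∈ W := hY₀.symm.mulVec_mem hW.invariant hm
  have hzero : ∀ X Y, ConjPair Γ X Y → X *ᵥ n = 0 → Y *ᵥ w = 0 := by
    intro X Y h hX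
    have h0 : X * rankOne n p = 0 := Matrix.ext_mulVec fun x => by
      rw [← mulVec_mulVec, rankOne_mulVec, mulVec_smul, hX, smul_zero, zero_mulVec]
    have h1 := h.mul hY₀
    rw [h0] at h1
    rw [hw, mulVec_mulVec]
    exact hW.mulVec_eq_zero_of_conjPair_zero htr h1 hm
  have hex : ∀ x ∈ W, ∃ X Y, ConjPair Γ X Y ∧ X *ᵥ n = x := fun x hx => by
    obtain ⟨Y, hY⟩ := hW.rankOne_mem (W.neg_mem hx) hn
    exact ⟨_, Y, hY, by rw [rankOne_mulVec, hnn, smul_neg, neg_smul, one_smul, neg_neg]⟩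
  choose! F G hFG hF using hex
  have hσ : ∀ X Y, ConjPair Γ X Y → G (X *ᵥ n) *ᵥ w = Y *ᵥ w := by
    intro X Y h
    have hXn := h.mulVec_mem hW.invariant hn
    have := hzero _ _ ((hFG _ hXn).sub h) (by rw [sub_mulVec, hF _ hXn, sub_self])
    rwa [sub_mulVec, sub_eq_zero] at this
  refine ⟨fun x => G x *ᵥ w, ?_, ?_, ?_, ?_, ?_⟩
  · intro x hx
    exact (hFG x hx).symm.mulVec_mem hW.invariant hwW
  · intro x hx y hy
    have := hσ _ _ ((hFG x hx).add (hFG y hy))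
    rwa [add_mulVec, add_mulVec, hF x hx, hF y hy] at this
  · intro c x hx
    have := hσ _ _ ((hFG x hx).smul c)
    rwa [smul_mulVec, smul_mulVec, hF x hx] at this
  · intro X Y h x hx
    have := hσ _ _ (h.mul (hFG x hx))
    rwa [← mulVec_mulVec, ← mulVec_mulVec, hF x hx] at this
  · refine ⟨n, hn, ?_⟩
    have := hσ _ _ ConjPair.one
    rw [one_mulVec, one_mulVec] at this
    change G n *ᵥ w ≠ 0
    rwa [this]

theorem conj_eq_zero (hW : IsHyperbolicCore Γ W) (hσ : IsConjugation Γ W σ) {x : Fin 4 → ℂ}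
    (hx : x ∈ W) (h : σ x = 0) : x = 0 := by
  by_contra hx0
  obtain ⟨v, hv, hxv⟩ : ∃ v ∈ W, β x v ≠ 0 := by
    by_contra! h'
    exact hx0 (hW.eq_zero_of_orthogonal hx h')
  obtain ⟨u, hu, hu0⟩ := hσ.exists_ne_zero
  obtain ⟨Y, hY⟩ := hW.rankOne_mem hu hv
  have := hσ.map_mulVec _ _ hY x hx
  rw [h, mulVec_zero, rankOne_mulVec, hσ.map_smul _ _ hu, smul_eq_zero] at this
  rcases this with h1 | h1
  · exact hxv ((map_eq_zero _).mp h1)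
  · exact hu0 h1

/-- A conjugation multiplies the Hermitian form by a real constant, and conjugates it. -/
theorem exists_hermForm_conj_conj (hW : IsHyperbolicCore Γ W) (hσ : IsConjugation Γ W σ) :
    ∃ μ : ℝ, ∀ x ∈ W, ∀ y ∈ W, β (σ x) (σ y) = μ * β y x := by
  obtain ⟨n, hn, hnn⟩ := hW.exists_eq_neg_one
  refine ⟨-(β (σ n) (σ n)).re, fun x hx y hy => ?_⟩
  obtain ⟨Y, hY⟩ := hW.rankOne_mem (W.neg_mem hx) hn
  have hx' : rankOne (-x) n *ᵥ n = x := by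
    rw [rankOne_mulVec, hnn, smul_neg, neg_smul, one_smul, neg_neg]
  have h1 := hσ.map_mulVec _ _ hY n hn
  have h2 := hσ.map_mulVec _ _ (hY.hermAdjoint hW.le) y hy
  rw [hx'] at h1
  rw [hermAdjoint_rankOne, rankOne_mulVec, hσ.map_smul _ _ hn] at h2
  rw [h1, hermForm_mulVec_left, ← h2, hermForm_smul_right, Complex.conj_conj, Complex.ofReal_neg,
    ← hermForm_self_eq_re, hermForm_neg_right]
  ring

/-- The square of a conjugation is a real scalar. -/
theorem exists_conj_conj (hW : IsHyperbolicCore Γ W) (hσ : IsConjugation Γ W σ) :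
    ∃ l : ℝ, ∀ x ∈ W, σ (σ x) = (l : ℂ) • x := by
  obtain ⟨n, hn, hnn⟩ := hW.exists_eq_neg_one
  have hl : ∀ x ∈ W, σ (σ x) = (-β (σ (σ n)) n) • x := by
    intro x hx
    obtain ⟨Y, hY⟩ := hW.rankOne_mem (W.neg_mem hx) hn
    have hx' : rankOne (-x) n *ᵥ n = x := by
      rw [rankOne_mulVec, hnn, smul_neg, neg_smul, one_smul, neg_neg]
    conv_lhs => rw [← hx', hσ.map_mulVec _ _ hY n hn, hσ.map_mulVec _ _ hY.symm _ (hσ.mem n hn),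
      rankOne_mulVec, smul_neg]
    rw [neg_smul]
  set l := -β (σ (σ n)) n
  have h1 := hl _ (hσ.mem n hn)
  rw [hl n hn, hσ.map_smul _ _ hn] at h1
  have hn0 : n ≠ 0 := fun h => by simp [h] at hnn
  have h2 := smul_left_injective ℂ (fun h => hn0 (hW.conj_eq_zero hσ hn h)) h1
  exact ⟨l.re, fun x hx => by rw [hl x hx, Complex.conj_eq_iff_re.mp h2]⟩

section

variable {l μ : ℝ}

theorem mul_hermForm_conj (hσ : IsConjugation Γ W σ)
    (hl : ∀ x ∈ W, σ (σ x) = (l : ℂ) • x) (hμ : ∀ x ∈ W, ∀ y ∈ W, β (σ x) (σ y) = μ * β y x)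
    {x y : Fin 4 → ℂ} (hx : x ∈ W) (hy : y ∈ W) : l * β y (σ x) = μ * β x (σ y) := by
  have := hμ x hx _ (hσ.mem y hy)
  rw [hl y hy, hermForm_smul_right, Complex.conj_ofReal] at this
  simpa [conj_hermForm] using congrArg conj this

theorem sq_eq_sq (hW : IsHyperbolicCore Γ W) (hσ : IsConjugation Γ W σ)
    (hl : ∀ x ∈ W, σ (σ x) = (l : ℂ) • x)
    (hμ : ∀ x ∈ W, ∀ y ∈ W, β (σ x) (σ y) = μ * β y x) : l ^ 2 = μ ^ 2 := by
  obtain ⟨n, hn, hnn⟩ := hW.exists_eq_neg_one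
  have h := mul_hermForm_conj hσ hl hμ (hσ.mem n hn) hn
  rw [hl n hn, hermForm_smul_right, hμ n hn n hn, hnn, Complex.conj_ofReal] at h
  have h' : ((l ^ 2 : ℝ) : ℂ) = ((μ ^ 2 : ℝ) : ℂ) := by
    push_cast
    linear_combination -h
  exact_mod_cast h'

theorem square_ne_zero (hW : IsHyperbolicCore Γ W) (hσ : IsConjugation Γ W σ)
    (hl : ∀ x ∈ W, σ (σ x) = (l : ℂ) • x) : l ≠ 0 := by
  rintro rfl
  obtain ⟨x, hx, hx0⟩ := hσ.exists_ne_zero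
  exact hx0 (hW.conj_eq_zero hσ (hσ.mem x hx) (by rw [hl x hx]; simp))

end

end IsHyperbolicCore

/-- The basis with Gram matrix `J` obtained from a frame. -/
noncomputable def hyperbolicBasis (v : Fin 4 → Fin 4 → ℂ) : Fin 4 → Fin 4 → ℂ :=
  ![((√2 / 2 : ℝ) : ℂ) • (v 1 + v 0), v 2, v 3, ((√2 / 2 : ℝ) : ℂ) • (v 1 - v 0)]

theorem half_sqrt_two_mul_self : ((√2 / 2 : ℝ) : ℂ) * ((√2 / 2 : ℝ) : ℂ) = 1 / 2 := by
  rw [← Complex.ofReal_mul, div_mul_div_comm, Real.mul_self_sqrt (by norm_num)]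
  norm_num

theorem IsFrame.hermForm_hyperbolicBasis {v : Fin 4 → Fin 4 → ℂ} (hv : IsFrame v) (i j : Fin 4) :
    β (hyperbolicBasis v j) (hyperbolicBasis v i) = formJ ℂ i j := by
  have hp := hv.pos
  have ho := hv.orthogonal
  have h2 := half_sqrt_two_mul_self
  fin_cases i <;> fin_cases j <;>
    simp [-Complex.ofReal_div, -Complex.coe_smul, hyperbolicBasis, formJ, hv.neg, hp, ho] <;>
    linear_combination 2 * h2

/-- The matrix whose columns are given vectors, up to a scalar, brings every matrix to the form
given by the products of the vectors. -/
theorem IsFrame.exists_conj {v : Fin 4 → Fin 4 → ℂ} (hv : IsFrame v) :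
    ∃ g ∈ SU31, ∀ γ : Matrix.SpecialLinearGroup (Fin 4) ℂ, ∀ i j, (g * γ * g⁻¹).val i j =
      β (γ.val *ᵥ hyperbolicBasis v j) (hyperbolicBasis v (Equiv.swap 0 3 i)) := by
  set b := hyperbolicBasis v with hb
  let P : Matrix (Fin 4) (Fin 4) ℂ := of fun i j => b j i
  have hcol : ∀ j, P *ᵥ Pi.single j 1 = b j := fun j => by
    ext i
    simp [P]
  have hentry : ∀ X : Matrix (Fin 4) (Fin 4) ℂ, ∀ i j,
      (Pᴴ * formJ ℂ * X * P) i j = β (X *ᵥ b j) (b i) := by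
    intro X i j
    rw [hermForm, ← hcol i, ← hcol j, star_mulVec, ← dotProduct_mulVec, mulVec_mulVec,
      mulVec_mulVec, mulVec_mulVec]
    simp [Matrix.mul_assoc]
  have hP : Pᴴ * formJ ℂ * P = formJ ℂ := by
    ext i j
    have := hentry 1 i j
    rw [Matrix.mul_one, one_mulVec] at this
    rw [this, hv.hermForm_hyperbolicBasis]
  have hdetJ : (formJ ℂ).det ≠ 0 := by
    intro h
    have := congrArg det formJ_mul_self
    rw [det_mul, h, det_one] at this
    simp at this
  have hdet : Complex.normSq P.det = 1 := by
    have := congrArg det hP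
    rw [det_mul, det_mul, det_conjTranspose] at this
    have h1 : P.det * conj P.det = 1 := by
      apply mul_right_cancel₀ hdetJ
      rw [one_mul]
      conv_rhs => rw [← this]
      simp only [RCLike.star_def]
      ring
    rw [Complex.mul_conj] at h1
    exact_mod_cast h1
  obtain ⟨c, hc⟩ := IsAlgClosed.exists_pow_nat_eq (P.det)⁻¹ (n := 4) (by norm_num)
  have hc1 : Complex.normSq c = 1 := by
    have := congrArg Complex.normSq hc
    rw [map_pow, map_inv₀, hdet, inv_one] at this
    exact (pow_eq_one_iff_of_nonneg (Complex.normSq_nonneg c) (by norm_num)).mp this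
  have hcc : c * conj c = 1 := by rw [Complex.mul_conj, hc1, Complex.ofReal_one]
  have hPdet : P.det ≠ 0 := fun h => by simp [h] at hdet
  let Q : Matrix.SpecialLinearGroup (Fin 4) ℂ := ⟨c • P, by
    rw [det_smul, Fintype.card_fin, hc, inv_mul_cancel₀ hPdet]⟩
  have hscal : ∀ X : Matrix (Fin 4) (Fin 4) ℂ, Q.valᴴ * formJ ℂ * X * Q.val
      = Pᴴ * formJ ℂ * X * P := fun X => by
    simp [Q, smul_smul, hcc]
  have hQ : Q ∈ SU31 := by
    have := hscal 1
    rw [Matrix.mul_one, Matrix.mul_one, hP] at this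
    exact this
  refine ⟨Q⁻¹, SU31.inv_mem hQ, fun γ i j => ?_⟩
  have hval : (Q⁻¹ * γ * Q⁻¹⁻¹).val = formJ ℂ * (Pᴴ * formJ ℂ * γ.val * P) := by
    rw [inv_inv, ← hscal]
    change (Q⁻¹).val * γ.val * Q.val = _
    rw [← hermAdjoint_of_mem hQ, hermAdjoint]
    simp only [Matrix.mul_assoc]
  rw [hval, Matrix.mul_apply, ← hentry]
  generalize Pᴴ * formJ ℂ * γ.val * P = Z
  fin_cases i <;> simp [formJ, Fin.sum_univ_four, Equiv.swap_apply_def]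

theorem mem_SO31_of_im_eq_zero {A : Matrix.SpecialLinearGroup (Fin 4) ℂ} (hA : A ∈ SU31)
    (h : ∀ i j, (A.val i j).im = 0) : A ∈ SO31 := by
  let R : Matrix (Fin 4) (Fin 4) ℝ := A.val.map Complex.re
  have hR : R.map Complex.ofRealHom = A.val := by
    ext i j
    exact Complex.ext (by simp [R]) (by simp [h])
  have hJ : (formJ ℝ).map Complex.ofRealHom = formJ ℂ := by
    ext i j
    fin_cases i <;> fin_cases j <;> simp [formJ]
  have hinj : Function.Injective fun M : Matrix (Fin 4) (Fin 4) ℝ => M.map Complex.ofRealHom :=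
    Matrix.map_injective Complex.ofRealHom.injective
  have hdet : R.det = 1 := by
    have : Complex.ofRealHom R.det = 1 := by
      rw [RingHom.map_det, RingHom.mapMatrix_apply, hR, A.2]
    simpa using this
  refine ⟨⟨R, hdet⟩, ?_, Subtype.ext hR⟩
  change Rᴴ * formJ ℝ * R = formJ ℝ
  apply hinj
  have hRH : Rᴴ.map Complex.ofRealHom = A.valᴴ := by
    rw [← hR]
    ext i j
    simp
  simp only [Matrix.map_mul, hR, hJ, hRH]
  exact hA

theorem mem_SU11xSU2_of_eq_zero {A : Matrix.SpecialLinearGroup (Fin 4) ℂ} (hA : A ∈ SU31)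
    (h01 : A.val 0 1 = 0) (h02 : A.val 0 2 = 0) (h31 : A.val 3 1 = 0) (h32 : A.val 3 2 = 0)
    (h10 : A.val 1 0 = 0) (h20 : A.val 2 0 = 0) (h13 : A.val 1 3 = 0) (h23 : A.val 2 3 = 0)
    (hdet : A.val 0 0 * A.val 3 3 - A.val 0 3 * A.val 3 0 = 1) : A ∈ SU11xSU2 := by
  let B : Matrix (Fin 2) (Fin 2) ℂ := !![A.val 0 0, A.val 0 3; A.val 3 0, A.val 3 3]
  let C : Matrix (Fin 2) (Fin 2) ℂ := !![A.val 1 1, A.val 1 2; A.val 2 1, A.val 2 2]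
  have hBC : blockMatrix B C = A.val := by
    ext i j
    fin_cases i <;> fin_cases j <;> simp [blockMatrix, B, C, *]
  have hB : B.det = 1 := by rw [det_fin_two_of, hdet]
  have hC : C.det = 1 := by
    have := A.2
    rwa [← hBC, det_blockMatrix, hB, one_mul] at this
  have hA' : A.valᴴ * formJ ℂ * A.val = formJ ℂ := hA
  rw [← hBC] at hA'
  have e : ∀ i j, ((blockMatrix B C)ᴴ * formJ ℂ * blockMatrix B C) i j = formJ ℂ i j :=
    fun i j => by rw [hA']
  refine ⟨(⟨B, hB⟩, ⟨C, hC⟩), ⟨?_, ?_⟩, Subtype.ext hBC⟩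
  · change Bᴴ * !![0, 1; 1, 0] * B = !![0, 1; 1, 0]
    have e00 := e 0 0
    have e03 := e 0 3
    have e30 := e 3 0
    have e33 := e 3 3
    simp [blockMatrix, formJ, Matrix.mul_apply, Fin.sum_univ_four] at e00 e03 e30 e33
    ext i j
    fin_cases i <;> fin_cases j <;> simp [Matrix.mul_apply, Fin.sum_univ_two] <;> assumption
  · change Cᴴ * 1 * C = 1
    have e11 := e 1 1
    have e12 := e 1 2
    have e21 := e 2 1
    have e22 := e 2 2
    simp [blockMatrix, formJ, Matrix.mul_apply, Fin.sum_univ_four] at e11 e12 e21 e22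
    ext i j
    fin_cases i <;> fin_cases j <;> simp [Matrix.mul_apply, Fin.sum_univ_two] <;> assumption

theorem exists_trace_eq_of_mem_SO31 {A : Matrix.SpecialLinearGroup (Fin 4) ℂ} (hA : A ∈ SO31) :
    ∃ x : ℝ, A.val.trace = (x : ℂ) := by
  obtain ⟨R, -, rfl⟩ := hA
  exact ⟨R.val.trace, by simp [Matrix.trace]⟩

theorem conj_trace_of_specialIsometryGroup {J : Matrix (Fin 2) (Fin 2) ℂ} (hJ : J * J = 1)
    {A : Matrix.SpecialLinearGroup (Fin 2) ℂ} (hA : A ∈ specialIsometryGroup J) :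
    conj A.val.trace = A.val.trace := by
  have hA' : A.valᴴ * J * A.val = J := hA
  have hinv : A.val * A.val.adjugate = 1 := by rw [mul_adjugate, A.2, one_smul]
  have h : A.valᴴ * J = J * A.val.adjugate := by
    rw [← Matrix.mul_one (A.valᴴ * J), ← hinv, ← Matrix.mul_assoc, hA']
  calc conj A.val.trace = (A.valᴴ * J * J).trace := by
        rw [Matrix.mul_assoc, hJ, Matrix.mul_one, trace_conjTranspose]; rfl
    _ = A.val.adjugate.trace := by
        rw [h, trace_mul_comm, ← Matrix.mul_assoc, hJ, Matrix.one_mul]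
    _ = A.val.trace := by simp [adjugate_fin_two, trace_fin_two, add_comm]

theorem exists_trace_eq_of_mem_SU11xSU2 {A : Matrix.SpecialLinearGroup (Fin 4) ℂ}
    (hA : A ∈ SU11xSU2) : ∃ x : ℝ, A.val.trace = (x : ℂ) := by
  obtain ⟨⟨B, C⟩, ⟨hB, hC⟩, rfl⟩ := hA
  have h1 := conj_trace_of_specialIsometryGroup (by ext i j; fin_cases i <;> fin_cases j <;> simp) hB
  have h2 := conj_trace_of_specialIsometryGroup (by simp) hC
  have htr : (blockEmbedding (B, C)).val.trace = B.val.trace + C.val.trace := by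
    change (blockMatrix B.val C.val).trace = _
    simp [blockMatrix, Matrix.trace, Fin.sum_univ_succ]
    ring
  rw [htr]
  obtain ⟨x, hx⟩ := Complex.conj_eq_iff_real.mp h1
  obtain ⟨y, hy⟩ := Complex.conj_eq_iff_real.mp h2
  exact ⟨x + y, by rw [hx, hy, Complex.ofReal_add]⟩

namespace IsHyperbolicCore

variable {Γ : Subgroup (Matrix.SpecialLinearGroup (Fin 4) ℂ)} {W : Submodule ℂ (Fin 4 → ℂ)}
  {σ : (Fin 4 → ℂ) → Fin 4 → ℂ} {l μ : ℝ}

theorem pos_of_three_le (hW : IsHyperbolicCore Γ W) (hσ : IsConjugation Γ W σ)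
    (hl : ∀ x ∈ W, σ (σ x) = (l : ℂ) • x) (hμ : ∀ x ∈ W, ∀ y ∈ W, β (σ x) (σ y) = μ * β y x)
    (h3 : 3 ≤ Module.finrank ℂ W) : 0 < μ := by
  by_contra hneg
  have hμ0 : μ ≠ 0 := fun h => hW.square_ne_zero hσ hl (by
    have := hW.sq_eq_sq hσ hl hμ
    rw [h] at this
    simpa using this)
  have hneg : μ < 0 := lt_of_le_of_ne (not_lt.mp hneg) hμ0
  obtain ⟨n, hn, hnn⟩ := hW.exists_neg
  obtain ⟨p, hp, hp0, hpn⟩ := exists_orthogonal_mem (U := W) ![n] (by simp; omega)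
  obtain ⟨q, hq, hq0, hqnp⟩ := exists_orthogonal_mem (U := W) ![n, p] (by simp; omega)
  have hσneg : ∀ x ∈ W, β x n = 0 → x ≠ 0 → (β (σ x) (σ x)).re < 0 := fun x hx hxn hx0 => by
    rw [hμ x hx x hx, Complex.re_ofReal_mul]
    exact mul_neg_of_neg_of_pos hneg
      (hermForm_pos_of_orthogonal hnn (hermForm_eq_zero_comm hxn) hx0)
  have h1 := hσneg p hp (hpn 0) hp0
  have h2 := hσneg q hq (hqnp 0) hq0
  have h3 := hermForm_pos_of_orthogonal h1 (y := σ q)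
    (by rw [hμ p hp q hq, show β q p = 0 from hqnp 1, mul_zero]) (ne_zero_of_hermForm_neg h2)
  linarith

theorem square_eq_of_pos (hW : IsHyperbolicCore Γ W) (hσ : IsConjugation Γ W σ)
    (hl : ∀ x ∈ W, σ (σ x) = (l : ℂ) • x) (hμ : ∀ x ∈ W, ∀ y ∈ W, β (σ x) (σ y) = μ * β y x)
    (hpos : 0 < μ) : l = μ := by
  obtain ⟨n, hn, hnn⟩ := hW.exists_neg
  have h := mul_hermForm_conj hσ hl hμ hn hn
  by_contra hne
  have h0 : β n (σ n) = 0 := by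
    rw [← sub_eq_zero, ← sub_mul, mul_eq_zero] at h
    refine h.resolve_left fun h => hne ?_
    exact_mod_cast sub_eq_zero.mp h
  have hneg : (β (σ n) (σ n)).re < 0 := by
    rw [hμ n hn n hn, Complex.re_ofReal_mul]
    exact mul_neg_of_pos_of_neg hpos hnn
  have := hermForm_pos_of_orthogonal hnn h0 (ne_zero_of_hermForm_neg hneg)
  linarith

/-- The vectors of `W` that a conjugation multiplies by `r`. They form a real subspace. -/
def fixedSet (W : Submodule ℂ (Fin 4 → ℂ)) (σ : (Fin 4 → ℂ) → Fin 4 → ℂ) (r : ℝ) :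
    Set (Fin 4 → ℂ) := {x | x ∈ W ∧ σ x = (r : ℂ) • x}

section

variable {r : ℝ}

theorem smul_add_conj_mem_fixedSet (hσ : IsConjugation Γ W σ)
    (hl : ∀ x ∈ W, σ (σ x) = ((r ^ 2 : ℝ) : ℂ) • x) {x : Fin 4 → ℂ} (hx : x ∈ W) :
    (r : ℂ) • x + σ x ∈ fixedSet W σ r := by
  refine ⟨W.add_mem (W.smul_mem _ hx) (hσ.mem x hx), ?_⟩
  rw [hσ.map_add _ (W.smul_mem _ hx) _ (hσ.mem x hx), hσ.map_smul _ _ hx, hl x hx,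
    Complex.conj_ofReal, Complex.ofReal_pow]
  module

theorem I_smul_sub_conj_mem_fixedSet (hσ : IsConjugation Γ W σ)
    (hl : ∀ x ∈ W, σ (σ x) = ((r ^ 2 : ℝ) : ℂ) • x) {x : Fin 4 → ℂ} (hx : x ∈ W) :
    Complex.I • ((r : ℂ) • x - σ x) ∈ fixedSet W σ r := by
  have h : Complex.I • ((r : ℂ) • x - σ x) = (Complex.I * r) • x + (-Complex.I) • σ x := by
    module
  rw [h]
  refine ⟨W.add_mem (W.smul_mem _ hx) (W.smul_mem _ (hσ.mem x hx)), ?_⟩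
  rw [hσ.map_add _ (W.smul_mem _ hx) _ (W.smul_mem _ (hσ.mem x hx)), hσ.map_smul _ _ hx,
    hσ.map_smul _ _ (hσ.mem x hx), hl x hx, map_mul, map_neg, Complex.conj_I,
    Complex.conj_ofReal, Complex.ofReal_pow]
  module

theorem exists_mem_fixedSet_neg (hW : IsHyperbolicCore Γ W) (hσ : IsConjugation Γ W σ)
    (hl : ∀ x ∈ W, σ (σ x) = ((r ^ 2 : ℝ) : ℂ) • x)
    (hμ : ∀ x ∈ W, ∀ y ∈ W, β (σ x) (σ y) = ((r ^ 2 : ℝ) : ℂ) * β y x) (hr : 0 < r) :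
    ∃ u ∈ fixedSet W σ r, (β u u).re < 0 := by
  obtain ⟨n, hn, hnn⟩ := hW.exists_neg
  by_contra! h
  have h1 := h _ (smul_add_conj_mem_fixedSet hσ hl hn)
  have h2 := h _ (I_smul_sub_conj_mem_fixedSet hσ hl hn)
  rw [hermForm_self_smul_re, Complex.normSq_I, one_mul] at h2
  have he : β ((r : ℂ) • n + σ n) ((r : ℂ) • n + σ n)
      + β ((r : ℂ) • n - σ n) ((r : ℂ) • n - σ n) = ((4 * r ^ 2 : ℝ) : ℂ) * β n n := by
    have := hμ n hn n hn
    simp only [hermForm_add_left, hermForm_add_right, hermForm_sub_left, hermForm_sub_right,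
      hermForm_smul_left, hermForm_smul_right, Complex.conj_ofReal, this]
    push_cast
    ring
  have he' := congrArg Complex.re he
  rw [Complex.add_re, Complex.re_ofReal_mul] at he'
  have : 4 * r ^ 2 * (β n n).re < 0 := mul_neg_of_pos_of_neg (by positivity) hnn
  linarith

theorem exists_mem_fixedSet_orthogonal (hσ : IsConjugation Γ W σ)
    (hl : ∀ x ∈ W, σ (σ x) = ((r ^ 2 : ℝ) : ℂ) • x)
    (hμ : ∀ x ∈ W, ∀ y ∈ W, β (σ x) (σ y) = ((r ^ 2 : ℝ) : ℂ) * β y x) (hr : 0 < r)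
    {ι : Type*} [Fintype ι] (v : ι → Fin 4 → ℂ) (hv : ∀ i, v i ∈ fixedSet W σ r)
    (hι : Fintype.card ι < Module.finrank ℂ W) :
    ∃ x ∈ fixedSet W σ r, x ≠ 0 ∧ ∀ i, β x (v i) = 0 := by
  obtain ⟨x, hx, hx0, hxv⟩ := exists_orthogonal_mem v hι
  have hr0 : (r : ℂ) ≠ 0 := by exact_mod_cast hr.ne'
  have hσv : ∀ i, β (σ x) (v i) = 0 := fun i => by
    have := hμ x hx _ (hv i).1
    rw [(hv i).2, hermForm_smul_right, Complex.conj_ofReal, hermForm_eq_zero_comm (hxv i),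
      mul_zero, mul_eq_zero] at this
    exact this.resolve_left hr0
  by_cases h : (r : ℂ) • x + σ x = 0
  · refine ⟨_, I_smul_sub_conj_mem_fixedSet hσ hl hx, fun h' => hx0 ?_, fun i => ?_⟩
    · have h2 := (smul_eq_zero.mp h').resolve_left Complex.I_ne_zero
      have h3 : ((2 : ℂ) * r) • x = 0 := by
        calc ((2 : ℂ) * r) • x = ((r : ℂ) • x + σ x) + ((r : ℂ) • x - σ x) := by module
          _ = 0 := by rw [h, h2, add_zero]
      exact (smul_eq_zero.mp h3).resolve_left (mul_ne_zero two_ne_zero hr0)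
    · rw [hermForm_smul_left, hermForm_sub_left, hermForm_smul_left, hxv, hσv]
      simp
  · refine ⟨_, smul_add_conj_mem_fixedSet hσ hl hx, h, fun i => ?_⟩
    rw [hermForm_add_left, hermForm_smul_left, hxv, hσv]
    simp

theorem hermForm_mulVec_im_eq_zero (hW : IsHyperbolicCore Γ W) (hσ : IsConjugation Γ W σ)
    (hμ : ∀ x ∈ W, ∀ y ∈ W, β (σ x) (σ y) = ((r ^ 2 : ℝ) : ℂ) * β y x) (hr : 0 < r)
    {γ : Matrix.SpecialLinearGroup (Fin 4) ℂ} (hγ : γ ∈ Γ) {x y : Fin 4 → ℂ}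
    (hx : x ∈ fixedSet W σ r) (hy : y ∈ fixedSet W σ r) : (β (γ.val *ᵥ x) y).im = 0 := by
  have h := hμ _ (hW.invariant γ hγ x hx.1) y hy.1
  rw [hσ.map_mulVec _ _ (ConjPair.of hγ) x hx.1, hx.2, hy.2, mulVec_smul, hermForm_smul_left,
    hermForm_smul_right, Complex.conj_ofReal, ← mul_assoc, ← Complex.ofReal_mul, ← sq] at h
  have hr0 : ((r ^ 2 : ℝ) : ℂ) ≠ 0 := by exact_mod_cast (pow_pos hr 2).ne'
  rw [← Complex.conj_eq_iff_im, conj_hermForm]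
  exact (mul_left_cancel₀ hr0 h).symm

end

theorem exists_conj_le_SO31 (hW : IsHyperbolicCore Γ W)
    (htr : ∀ γ ∈ Γ, ∃ x : ℝ, (γ : Matrix (Fin 4) (Fin 4) ℂ).trace = (x : ℂ))
    (h3 : 3 ≤ Module.finrank ℂ W) :
    ∃ g ∈ SU31, Γ.map (MulAut.conj g).toMonoidHom ≤ SO31 := by
  obtain ⟨σ, hσ⟩ := hW.exists_isConjugation htr
  obtain ⟨l, hl⟩ := hW.exists_conj_conj hσ
  obtain ⟨μ, hμ⟩ := hW.exists_hermForm_conj_conj hσ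
  have hpos := hW.pos_of_three_le hσ hl hμ h3
  obtain rfl := hW.square_eq_of_pos hσ hl hμ hpos
  obtain ⟨r, hr, rfl⟩ : ∃ r : ℝ, 0 < r ∧ r ^ 2 = l := ⟨√l, Real.sqrt_pos.mpr hpos,
    Real.sq_sqrt hpos.le⟩
  have hcompl := Submodule.finrank_add_eq_of_isCompl hW.isCompl
  rw [Module.finrank_fin_fun] at hcompl
  obtain ⟨v, hv, hvC⟩ := exists_isFrame
    (fun i => {x | (i.val < Module.finrank ℂ W → x ∈ fixedSet W σ r) ∧
      (¬ i.val < Module.finrank ℂ W → x ∈ hermOrthogonal W)})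
    (by
      rintro i x ⟨h1, h2⟩ s
      refine ⟨fun h => ⟨W.smul_mem _ (h1 h).1, ?_⟩, fun h => (hermOrthogonal W).smul_mem _ (h2 h)⟩
      rw [hσ.map_smul _ _ (h1 h).1, (h1 h).2, Complex.conj_ofReal, smul_comm])
    (by
      obtain ⟨u, hu, hneg⟩ := hW.exists_mem_fixedSet_neg hσ hl hμ hr
      exact ⟨u, ⟨fun _ => hu, fun h => absurd (show 0 < Module.finrank ℂ W by omega) h⟩, hneg⟩)
    (by
      intro i hi w hw
      by_cases hiW : i.val < Module.finrank ℂ W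
      · obtain ⟨x, hx, hx0, hxw⟩ := exists_mem_fixedSet_orthogonal hσ hl hμ hr
          (fun j : Fin i => w (j.castLE i.2.le))
          (fun j => (hw (j.castLE i.2.le) j.2).1 (j.2.trans hiW)) (by simpa using hiW)
        exact ⟨x, ⟨fun _ => hx, fun h => absurd hiW h⟩, hx0, fun j hj => hxw ⟨j, hj⟩⟩
      · have hbot : hermOrthogonal W ≠ ⊥ := fun h => by
          rw [h, finrank_bot] at hcompl
          have := i.2
          omega
        obtain ⟨x, hx, hx0⟩ := Submodule.exists_mem_ne_zero_of_ne_bot hbot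
        refine ⟨x, ⟨fun h => absurd h hiW, fun _ => hx⟩, hx0, fun j hj => hx _ ?_⟩
        refine ((hw j hj).1 ?_).1
        have := i.2
        have : j.val < i.val := hj
        omega)
  obtain ⟨g, hg, hgγ⟩ := hv.exists_conj
  refine ⟨g, hg, ?_⟩
  rintro _ ⟨γ, hγ, rfl⟩
  have hdiag : ∀ i : Fin 4, i.val < 3 → v i ∈ fixedSet W σ r := fun i hi => (hvC i).1 (by omega)
  have hreal : ∀ i j : Fin 4, i.val < 3 → j.val < 3 → (β (γ.val *ᵥ v i) (v j)).im = 0 :=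
    fun i j hi hj => hW.hermForm_mulVec_im_eq_zero hσ hμ hr hγ (hdiag i hi) (hdiag j hj)
  have hreal3 : ∀ i : Fin 4, i.val < 3 →
      (β (γ.val *ᵥ v i) (v 3)).im = 0 ∧ (β (γ.val *ᵥ v 3) (v i)).im = 0 := by
    intro i hi
    by_cases h4 : 3 < Module.finrank ℂ W
    · have h3' : v 3 ∈ fixedSet W σ r := (hvC 3).1 h4
      exact ⟨hW.hermForm_mulVec_im_eq_zero hσ hμ hr hγ (hdiag i hi) h3',
        hW.hermForm_mulVec_im_eq_zero hσ hμ hr hγ h3' (hdiag i hi)⟩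
    · have h3' : v 3 ∈ hermOrthogonal W := (hvC 3).2 h4
      constructor
      · rw [hermForm_eq_zero_comm (h3' _ (hW.invariant γ hγ _ (hdiag i hi).1)), Complex.zero_im]
      · rw [hW.invariant.orthogonal hW.le γ hγ _ h3' _ (hdiag i hi).1, Complex.zero_im]
  have hreal33 : (β (γ.val *ᵥ v 3) (v 3)).im = 0 := by
    obtain ⟨x, hx⟩ := htr γ hγ
    rw [hv.trace_eq] at hx
    have := congrArg Complex.im hx
    simp only [Complex.add_im, Complex.neg_im, Complex.ofReal_im] at this
    linarith [hreal 0 0 (by decide) (by decide), hreal 1 1 (by decide) (by decide),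
      hreal 2 2 (by decide) (by decide)]
  have hall : ∀ i j, (β (γ.val *ᵥ v j) (v i)).im = 0 := by
    intro i j
    by_cases hi : i = 3
    · subst hi
      by_cases hj : j = 3
      · exact hj ▸ hreal33
      · exact (hreal3 j (by omega)).1
    · by_cases hj : j = 3
      · exact hj ▸ (hreal3 i (by omega)).2
      · exact hreal j i (by omega) (by omega)
  refine mem_SO31_of_im_eq_zero (SU31.mul_mem (SU31.mul_mem hg (hW.le hγ)) (SU31.inv_mem hg))
    fun i j => ?_
  change ((g * γ * g⁻¹).val i j).im = 0
  rw [hgγ]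
  generalize Equiv.swap 0 3 i = i'
  fin_cases i' <;> fin_cases j <;>
    simp [-Complex.ofReal_div, -Complex.coe_smul, hyperbolicBasis, mulVec_add, mulVec_sub,
      mulVec_smul, Complex.conj_ofReal, hall]

end IsHyperbolicCore

/-- The zeros of a nonzero binary quadratic form over `ℂ` lie on two lines. -/
theorem exists_zeros_binary_quadratic {a b c : ℂ} (h : a ≠ 0 ∨ b ≠ 0) :
    ∃ p q : ℂ × ℂ, p ≠ 0 ∧ a * p.1 ^ 2 + 2 * b * p.1 * p.2 + c * p.2 ^ 2 = 0 ∧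
      ∀ x : ℂ × ℂ, a * x.1 ^ 2 + 2 * b * x.1 * x.2 + c * x.2 ^ 2 = 0 →
        ∃ t : ℂ, x = t • p ∨ x = t • q := by
  by_cases ha : a = 0
  · have hb := h.resolve_left (fun h => h ha)
    refine ⟨(1, 0), (-c, 2 * b), by simp, by simp [ha], fun x hx => ?_⟩
    rw [ha] at hx
    have : x.2 * (2 * b * x.1 + c * x.2) = 0 := by linear_combination hx
    rcases mul_eq_zero.mp this with h2 | h2
    · exact ⟨x.1, Or.inl (Prod.ext (by simp) (by simp [h2]))⟩
    · refine ⟨x.2 / (2 * b), Or.inr (Prod.ext ?_ ?_)⟩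
      · simp only [Prod.smul_fst, smul_eq_mul]
        field_simp
        linear_combination h2
      · simp only [Prod.smul_snd, smul_eq_mul]
        field_simp
  · obtain ⟨s, hs⟩ := IsAlgClosed.exists_pow_nat_eq (b ^ 2 - a * c) (n := 2) (by norm_num)
    refine ⟨(-b + s, a), (-b - s, a), fun h => ha (congrArg Prod.snd h), ?_, fun x hx => ?_⟩
    · simp only
      linear_combination a * hs
    · have : (a * x.1 - (-b + s) * x.2) * (a * x.1 - (-b - s) * x.2) = 0 := by
        linear_combination a * hx - x.2 ^ 2 * hs
      rcases mul_eq_zero.mp this with h2 | h2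
      · refine ⟨x.2 / a, Or.inl (Prod.ext ?_ ?_)⟩
        · simp only [Prod.smul_fst, smul_eq_mul]
          field_simp
          linear_combination h2
        · simp only [Prod.smul_snd, smul_eq_mul]
          field_simp
      · refine ⟨x.2 / a, Or.inr (Prod.ext ?_ ?_)⟩
        · simp only [Prod.smul_fst, smul_eq_mul]
          field_simp
          linear_combination h2
        · simp only [Prod.smul_snd, smul_eq_mul]
          field_simp

/-- In a hyperbolic plane, the product of the norms of orthogonal vectors is not positive. -/
theorem mul_hermForm_nonpos {e f x y : Fin 4 → ℂ} (hee : β e e = 0) (hff : β f f = 0)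
    (hef : β e f = 1) (hx : ∃ a b : ℂ, x = a • e + b • f) (hy : ∃ a b : ℂ, y = a • e + b • f)
    (hxy : β x y = 0) : (β x x).re * (β y y).re ≤ 0 := by
  obtain ⟨a, b, rfl⟩ := hx
  obtain ⟨c, d, rfl⟩ := hy
  have hfe : β f e = 1 := by rw [← conj_hermForm, hef, map_one]
  have h : β (a • e + b • f) (a • e + b • f) * β (c • e + d • f) (c • e + d • f) =
      β (a • e + b • f) (c • e + d • f) * β (c • e + d • f) (a • e + b • f)
        - (a * d - b * c) * conj (a * d - b * c) := by
    simp only [hermForm_add_left, hermForm_add_right, hermForm_smul_left, hermForm_smul_right, hee,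
      hff, hef, hfe, map_sub, map_mul]
    ring
  rw [hxy, zero_mul, zero_sub, Complex.mul_conj, hermForm_self_eq_re (a • e + b • f),
    hermForm_self_eq_re (c • e + d • f)] at h
  have h' : (β (a • e + b • f) (a • e + b • f)).re * (β (c • e + d • f) (c • e + d • f)).re =
      -Complex.normSq (a * d - b * c) := by exact_mod_cast h
  rw [h']
  exact neg_nonpos.mpr (Complex.normSq_nonneg _)

namespace IsHyperbolicCore

variable {Γ : Subgroup (Matrix.SpecialLinearGroup (Fin 4) ℂ)} {W : Submodule ℂ (Fin 4 → ℂ)}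
  {σ : (Fin 4 → ℂ) → Fin 4 → ℂ} {l μ : ℝ}

/-- The form `⟨x, σ y⟩` of a conjugation `σ` is bilinear. -/
theorem hermForm_conj_bilinear (hσ : IsConjugation Γ W σ) {e f : Fin 4 → ℂ} (he : e ∈ W)
    (hf : f ∈ W) (a b c d : ℂ) : β (a • e + b • f) (σ (c • e + d • f)) =
      a * c * β e (σ e) + a * d * β e (σ f) + b * c * β f (σ e) + b * d * β f (σ f) := by
  rw [hσ.map_add _ (W.smul_mem _ he) _ (W.smul_mem _ hf), hσ.map_smul _ _ he, hσ.map_smul _ _ hf]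
  simp
  ring

theorem hermForm_mulVec_conj_mulVec (hW : IsHyperbolicCore Γ W) (hσ : IsConjugation Γ W σ)
    {γ : Matrix.SpecialLinearGroup (Fin 4) ℂ} (hγ : γ ∈ Γ) (x : Fin 4 → ℂ) {y : Fin 4 → ℂ}
    (hy : y ∈ W) : β (γ.val *ᵥ x) (σ (γ.val *ᵥ y)) = β x (σ y) := by
  rw [hσ.map_mulVec _ _ (ConjPair.of hγ) y hy, hermForm_mulVec_mulVec (hW.le hγ)]

section

variable {e f : Fin 4 → ℂ}

/-- A plane on which the bilinear form of a conjugation is symmetric has only two isotropic lines,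
so that the group is elementary. -/
theorem isElementary_of_square_eq (hW : IsHyperbolicCore Γ W) (hσ : IsConjugation Γ W σ)
    (hl : ∀ x ∈ W, σ (σ x) = (l : ℂ) • x) (hμ : ∀ x ∈ W, ∀ y ∈ W, β (σ x) (σ y) = μ * β y x)
    (he : e ∈ W) (hf : f ∈ W) (hee : β e e = 0) (hff : β f f = 0) (hef : β e f = 1)
    (hspan : ∀ x ∈ W, ∃ a b : ℂ, x = a • e + b • f) (hlμ : l = μ) : IsElementary Γ := by
  have hl0 := hW.square_ne_zero hσ hl
  subst hlμ
  have hsymm : β f (σ e) = β e (σ f) :=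
    mul_left_cancel₀ (Complex.ofReal_ne_zero.mpr hl0) (mul_hermForm_conj hσ hl hμ he hf)
  have he0 : e ≠ 0 := fun h => by simp [h] at hef
  have hf0 : f ≠ 0 := fun h => by simp [h] at hef
  have hquad : ∀ x : ℂ × ℂ, β (x.1 • e + x.2 • f) (σ (x.1 • e + x.2 • f)) =
      β e (σ e) * x.1 ^ 2 + 2 * β e (σ f) * x.1 * x.2 + β f (σ f) * x.2 ^ 2 := fun x => by
    rw [hermForm_conj_bilinear hσ he hf, hsymm]
    ring
  have hne : β e (σ e) ≠ 0 ∨ β e (σ f) ≠ 0 := by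
    by_contra! h
    refine he0 (hW.conj_eq_zero hσ he (hW.eq_zero_of_orthogonal (hσ.mem e he) fun y hy => ?_))
    obtain ⟨a, b, rfl⟩ := hspan y hy
    rw [← conj_hermForm, hermForm_add_left, hermForm_smul_left, hermForm_smul_left, h.1, hsymm, h.2]
    simp
  obtain ⟨p, q, hp0, hp, hpq⟩ := exists_zeros_binary_quadratic (c := β f (σ f)) hne
  set x := p.1 • e + p.2 • f with hx
  set z := q.1 • e + q.2 • f with hz
  have hxW : x ∈ W := W.add_mem (W.smul_mem _ he) (W.smul_mem _ hf)
  have hzW : z ∈ W := W.add_mem (W.smul_mem _ he) (W.smul_mem _ hf)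
  have hxx : β x (σ x) = 0 := by rw [hx, hquad, hp]
  have hx0 : x ≠ 0 := by
    intro h
    have hfe : β f e = 1 := by rw [← conj_hermForm, hef, map_one]
    have h1 : β x f = p.1 := by simp [hx, hff, hef]
    have h2 : β x e = p.2 := by simp [hx, hee, hfe]
    rw [h, hermForm_zero_left] at h1 h2
    exact hp0 (Prod.ext h1.symm h2.symm)
  have horbit : ∀ γ ∈ Γ, ∃ t : ℂ, γ.val *ᵥ x = t • x ∨ γ.val *ᵥ x = t • z := by
    intro γ hγ
    obtain ⟨a, b, hab⟩ := hspan _ (hW.invariant γ hγ x hxW)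
    have h1 := hW.hermForm_mulVec_conj_mulVec hσ hγ x hxW
    rw [hxx, hab, hquad (a, b)] at h1
    obtain ⟨t, ht | ht⟩ := hpq (a, b) h1
    · refine ⟨t, Or.inl ?_⟩
      rw [hab, hx, smul_add, smul_smul, smul_smul, show a = t * p.1 from congrArg Prod.fst ht,
        show b = t * p.2 from congrArg Prod.snd ht]
    · refine ⟨t, Or.inr ?_⟩
      rw [hab, hz, smul_add, smul_smul, smul_smul, show a = t * q.1 from congrArg Prod.fst ht,
        show b = t * q.2 from congrArg Prod.snd ht]
  by_cases hle : (β x x).re ≤ 0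
  · refine isElementary_of_finite_lines hx0 hle (Set.toFinite {x, z}) fun γ hγ => ?_
    obtain ⟨t, ht | ht⟩ := horbit γ hγ
    · exact ⟨x, by simp, t, ht⟩
    · exact ⟨z, by simp, t, ht⟩
  · have hle' : (β (σ x) (σ x)).re ≤ 0 := by
      have h1 := mul_hermForm_nonpos hee hff hef (hspan x hxW) (hspan _ (hσ.mem x hxW)) hxx
      by_contra h
      exact absurd h1 (not_le.mpr (mul_pos (not_le.mp hle) (not_le.mp h)))
    refine isElementary_of_finite_lines (fun h => hx0 (hW.conj_eq_zero hσ hxW h)) hle'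
      (Set.toFinite {σ x, σ z}) fun γ hγ => ?_
    rw [← hσ.map_mulVec _ _ (ConjPair.of hγ) x hxW]
    obtain ⟨t, ht | ht⟩ := horbit γ hγ
    · exact ⟨σ x, by simp, conj t, by rw [ht, hσ.map_smul _ _ hxW]⟩
    · exact ⟨σ z, by simp, conj t, by rw [ht, hσ.map_smul _ _ hzW]⟩

/-- If the bilinear form of a conjugation on a plane is alternating, then the group acts on the
plane with determinant one. -/
theorem det_eq_one_of_square_eq_neg (hW : IsHyperbolicCore Γ W) (hσ : IsConjugation Γ W σ)
    (hl : ∀ x ∈ W, σ (σ x) = (l : ℂ) • x) (hμ : ∀ x ∈ W, ∀ y ∈ W, β (σ x) (σ y) = μ * β y x)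
    (he : e ∈ W) (hf : f ∈ W) (hef : β e f = 1)
    (hspan : ∀ x ∈ W, x = β x f • e + β x e • f) (hlμ : l = -μ)
    {γ : Matrix.SpecialLinearGroup (Fin 4) ℂ} (hγ : γ ∈ Γ) :
    β (γ.val *ᵥ e) f * β (γ.val *ᵥ f) e - β (γ.val *ᵥ f) f * β (γ.val *ᵥ e) e = 1 := by
  have hl0 : (l : ℂ) ≠ 0 := Complex.ofReal_ne_zero.mpr (hW.square_ne_zero hσ hl)
  have hanti : ∀ x ∈ W, ∀ y ∈ W, β y (σ x) = -β x (σ y) := fun x hx y hy => by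
    have := mul_hermForm_conj hσ hl hμ hx hy
    apply mul_left_cancel₀ hl0
    rw [this, hlμ]
    push_cast
    ring
  have halt : ∀ x ∈ W, β x (σ x) = 0 := fun x hx => self_eq_neg.mp (hanti x hx x hx)
  have hne : β e (σ f) ≠ 0 := by
    intro h
    have hf0 : f ≠ 0 := fun h => by simp [h] at hef
    refine hf0 (hW.conj_eq_zero hσ hf (hW.eq_zero_of_orthogonal (hσ.mem f hf) fun y hy => ?_))
    rw [hspan y hy, ← conj_hermForm, hermForm_add_left, hermForm_smul_left, hermForm_smul_left, h,
      halt f hf]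
    simp
  have h1 := hW.hermForm_mulVec_conj_mulVec hσ hγ e hf
  rw [hspan _ (hW.invariant γ hγ e he), hspan _ (hW.invariant γ hγ f hf),
    hermForm_conj_bilinear hσ he hf, halt e he, halt f hf, hanti e he f hf] at h1
  apply mul_right_cancel₀ hne
  linear_combination h1

end

theorem exists_conj_le_SU11xSU2 (hW : IsHyperbolicCore Γ W) (hne : ¬ IsElementary Γ)
    (htr : ∀ γ ∈ Γ, ∃ x : ℝ, (γ : Matrix (Fin 4) (Fin 4) ℂ).trace = (x : ℂ))
    (h2 : Module.finrank ℂ W = 2) :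
    ∃ g ∈ SU31, Γ.map (MulAut.conj g).toMonoidHom ≤ SU11xSU2 := by
  obtain ⟨σ, hσ⟩ := hW.exists_isConjugation htr
  obtain ⟨l, hl⟩ := hW.exists_conj_conj hσ
  obtain ⟨μ, hμ⟩ := hW.exists_hermForm_conj_conj hσ
  have hcompl := Submodule.finrank_add_eq_of_isCompl hW.isCompl
  rw [Module.finrank_fin_fun, h2] at hcompl
  obtain ⟨v, hv, hvC⟩ := exists_isFrame
    ![(W : Set (Fin 4 → ℂ)), W, hermOrthogonal W, hermOrthogonal W]
    (by
      intro i x hx s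
      fin_cases i <;> exact Submodule.smul_mem _ _ hx)
    hW.exists_neg
    (by
      intro i hi w hw
      fin_cases i
      · exact absurd rfl hi
      · obtain ⟨x, hx, hx0, hxw⟩ := exists_orthogonal_mem (U := W) ![w 0] (by simp [h2])
        refine ⟨x, hx, hx0, fun j hj => ?_⟩
        fin_cases j <;> first | exact hxw 0 | exact absurd hj (by decide)
      · obtain ⟨x, hx, hx0, -⟩ := exists_orthogonal_mem (U := hermOrthogonal W) ![] (by simp; omega)
        refine ⟨x, hx, hx0, fun j hj => ?_⟩
        have := hw j hj
        fin_cases j <;> first | exact hx _ this | exact absurd hj (by decide)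
      · obtain ⟨x, hx, hx0, hxw⟩ := exists_orthogonal_mem (U := hermOrthogonal W) ![w 2]
          (by simp; omega)
        refine ⟨x, hx, hx0, fun j hj => ?_⟩
        have := hw j hj
        fin_cases j <;> first | exact hxw 0 | exact hx _ this | exact absurd hj (by decide))
  obtain ⟨g, hg, hgγ⟩ := hv.exists_conj
  have hgram := hv.hermForm_hyperbolicBasis
  set b := hyperbolicBasis v with hb
  have hb0 : b 0 ∈ W := W.smul_mem _ (W.add_mem (hvC 1) (hvC 0))
  have hb3 : b 3 ∈ W := W.smul_mem _ (W.sub_mem (hvC 1) (hvC 0))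
  have hb1 : b 1 ∈ hermOrthogonal W := hvC 2
  have hb2 : b 2 ∈ hermOrthogonal W := hvC 3
  have h03 : β (b 0) (b 3) = 1 := by simp [hgram, formJ]
  have h00 : β (b 0) (b 0) = 0 := by simp [hgram, formJ]
  have h33 : β (b 3) (b 3) = 0 := by simp [hgram, formJ]
  have hspan : ∀ x ∈ W, x = β x (b 3) • b 0 + β x (b 0) • b 3 := by
    intro x hx
    have h2' := hermForm_eq_zero_comm (show β (v 2) x = 0 from hb1 x hx)
    have h3' := hermForm_eq_zero_comm (show β (v 3) x = 0 from hb2 x hx)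
    have h := hv.eq_sum x
    rw [h2', h3', zero_smul, zero_smul, add_zero, add_zero] at h
    have e0 : b 0 = ((√2 / 2 : ℝ) : ℂ) • (v 1 + v 0) := rfl
    have e3 : b 3 = ((√2 / 2 : ℝ) : ℂ) • (v 1 - v 0) := rfl
    rw [e0, e3, hermForm_smul_right, hermForm_smul_right, Complex.conj_ofReal, hermForm_add_right,
      hermForm_sub_right]
    conv_lhs => rw [h]
    have hs := half_sqrt_two_mul_self
    generalize ((√2 / 2 : ℝ) : ℂ) = s at hs
    have h4 : ∀ u w : ℂ, (s * (u - w)) • s • (v 1 + v 0) + (s * (u + w)) • s • (v 1 - v 0) =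
        (2 * (s * s)) • (u • v 1 - w • v 0) := fun u w => by module
    rw [h4, hs]
    module
  have hlμ : l = -μ := (sq_eq_sq_iff_eq_or_eq_neg.mp (hW.sq_eq_sq hσ hl hμ)).resolve_left fun h =>
    hne (hW.isElementary_of_square_eq hσ hl hμ hb0 hb3 h00 h33 h03
      (fun x hx => ⟨_, _, hspan x hx⟩) h)
  refine ⟨g, hg, ?_⟩
  rintro _ ⟨γ, hγ, rfl⟩
  have hWO : ∀ x ∈ W, ∀ y ∈ hermOrthogonal W, β (γ.val *ᵥ x) y = 0 := fun x hx y hy =>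
    hermForm_eq_zero_comm (hy _ (hW.invariant γ hγ x hx))
  have hOW : ∀ x ∈ hermOrthogonal W, ∀ y ∈ W, β (γ.val *ᵥ x) y = 0 := fun x hx y hy =>
    hW.invariant.orthogonal hW.le γ hγ x hx y hy
  have s0 : Equiv.swap (0 : Fin 4) 3 0 = 3 := by decide
  have s1 : Equiv.swap (0 : Fin 4) 3 1 = 1 := by decide
  have s2 : Equiv.swap (0 : Fin 4) 3 2 = 2 := by decide
  have s3 : Equiv.swap (0 : Fin 4) 3 3 = 0 := by decide
  change g * γ * g⁻¹ ∈ SU11xSU2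
  apply mem_SU11xSU2_of_eq_zero
    (SU31.mul_mem (SU31.mul_mem hg (hW.le hγ)) (SU31.inv_mem hg)) <;>
    simp only [hgγ, s0, s1, s2, s3]
  · exact hOW _ hb1 _ hb3
  · exact hOW _ hb2 _ hb3
  · exact hOW _ hb1 _ hb0
  · exact hOW _ hb2 _ hb0
  · exact hWO _ hb0 _ hb1
  · exact hWO _ hb0 _ hb2
  · exact hWO _ hb3 _ hb1
  · exact hWO _ hb3 _ hb2
  · exact hW.det_eq_one_of_square_eq_neg hσ hl hμ hb0 hb3 h03 hspan hlμ hγ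

end IsHyperbolicCore

theorem mainTheorem1 (Γ : Subgroup (Matrix.SpecialLinearGroup (Fin 4) ℂ)) (hΓ : Γ ≤ SU31)
    (hdisc : DiscreteTopology Γ) (hne : ¬ IsElementary Γ) :
    (∀ γ ∈ Γ, ∃ x : ℝ, (γ : Matrix (Fin 4) (Fin 4) ℂ).trace = (x : ℂ)) ↔
      ∃ g ∈ SU31, Γ.map (MulAut.conj g).toMonoidHom ≤ SO31 ∨
        Γ.map (MulAut.conj g).toMonoidHom ≤ SU11xSU2 := by
  constructor
  · intro htr
    obtain ⟨W, hW⟩ := exists_isHyperbolicCore hΓ hne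
    rcases hW.two_le.eq_or_lt with h2 | h3
    · obtain ⟨g, hg, h⟩ := hW.exists_conj_le_SU11xSU2 hne htr h2.symm
      exact ⟨g, hg, Or.inr h⟩
    · obtain ⟨g, hg, h⟩ := hW.exists_conj_le_SO31 htr h3
      exact ⟨g, hg, Or.inl h⟩
  · rintro ⟨g, -, h⟩ γ hγ
    have hmem : g * γ * g⁻¹ ∈ Γ.map (MulAut.conj g).toMonoidHom := ⟨γ, hγ, rfl⟩
    have htrace : (g * γ * g⁻¹).val.trace = γ.val.trace := by
      change (g.val * γ.val * (g⁻¹).val).trace = _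
      have hinv : (g⁻¹).val * g.val = 1 := congrArg Subtype.val (inv_mul_cancel g)
      rw [trace_mul_comm, ← Matrix.mul_assoc, hinv, Matrix.one_mul]
    rw [← htrace]
    rcases h with h | h
    · exact exists_trace_eq_of_mem_SO31 (h hmem)
    · exact exists_trace_eq_of_mem_SU11xSU2 (h hmem)
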